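/- All lattices are finite. An element $x$ of a lattice is *reducible* if $x=y\vee z$ or $x=y\wedge z$ for some $y,z\ne x$. The *nullity* of a poset is the nullity (number of edges minus number of vertices plus number of components) of its cover graph. A (maximal) *block* is a lattice in which the least and the greatest element are reducible. For a poset $P$, let $\mathrm{Irr}(P)$ be the set of elements with at most one lower cover and at most one upper cover, and $\mathrm{Red}(P)=P\setminus\mathrm{Irr}(P)$. An element $x\in\mathrm{Irr}(P)$ is *retractible* if either there are no $y,z\in \mathrm{Red}(P)$ with $y\prec x\prec z$, or there are such $y,z$ and there is no other directed path from $y$ to $z$ in the cover graph. The *basic block associated to* $P$ is obtained from $P$ by successively removing retractible elements (never the last element) until none is left, and then successively removing pendant vertices of the cover graph until none is left. Let $B_8$ be the nine-element poset with covering relations $0\prec a\prec b\prec c\prec x\prec 1$, $0\prec c_1\prec b$, $a\prec c_2\prec c$, $c\prec c_3\prec 1$, and let $B_9=B_8^{*}$ be its dual. For $i\in\{8,9\}$ let $\mathbb{B}_i(j;5,3)$ be the class, up to isomorphism, of all blocks on $j$ elements that have exactly five reducible elements, these being pairwise comparable, have nullity $3$, and have $B_i$ as associated basic block. Let $\mathscr{B}(j;r,k,h)$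 be the class, up to isomorphism, of all blocks on $j$ elements that have exactly $r$ reducible elements, these being pairwise comparable, have nullity $k$, and whose associated basic block has height $h$ (the maximal number of coverings in a chain). Let $P_n^{k}$ be the number of partitions of the integer $n$ into exactly $k$ positive parts, and let $L'\circ L''$ denote the vertical sum, in which the greatest element of $L'$ is identified with the least element of $L''$. **Proposition.** Let $j\ge 9$. Then $$|\mathbb{B}_8(j;5,3)|=|\mathbb{B}_9(j;5,3)|=\sum_{p=6}^{j-3}\binom{p-2}{4}P^{2}_{j-p-1}.$$ A lattice $\mathbf{B}$ on $j$ elements belongs to $\mathbb{B}_9(j;5,3)$ if and only if its dual $\mathbf{B}^{*}$ belongs to $\mathbb{B}_8(j;5,3)$. Moreover, a lattice $\mathbf{B}$ on $j$ elements belongs to $\mathbb{B}_8(j;5,3)$ if and only if $\mathbf{B}\cong\mathbf{B}'\circ\mathbf{B}''$ for some $\mathbf{B}'\in\mathscr{B}(p;4,2,3)$ and $\mathbf{B}''\in\mathscr{B}(q;2,1,2)$ with $p\ge 6$, $q\ge 4$ and $p+q-1=j$. -/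

import Mathlib

/-! ### Reducible elements, nullity, blocks -/

/-- `x` is a reducible element of the lattice `α`: it is the join, or the meet, of two elements
both different from `x`. -/
def IsReducibleElt {α : Type*} [Lattice α] (x : α) : Prop :=
  (∃ y z : α, y ≠ x ∧ z ≠ x ∧ y ⊔ z = x) ∨ (∃ y z : α, y ≠ x ∧ z ≠ x ∧ y ⊓ z = x)

/-- The nullity of a finite poset: the nullity (cyclomatic number)
`|edges| - |vertices| + |connected components|` of its cover graph. -/
noncomputable def posetNullity (α : Type*) [PartialOrder α] : ℤ :=
  ((SimpleGraph.hasse α).edgeSet.ncard : ℤ) - (Nat.card α : ℤ)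
    + (Nat.card (SimpleGraph.hasse α).ConnectedComponent : ℤ)

/-- A block: a lattice with a least and a greatest element, both of which are reducible. -/
def IsBlock (α : Type*) [Lattice α] : Prop :=
  (∃ x : α, IsBot x ∧ IsReducibleElt x) ∧ (∃ x : α, IsTop x ∧ IsReducibleElt x)

/-- `α` is a block with exactly `r` reducible elements, any two of them comparable,
and of nullity `k`. -/
def IsRCBlock (α : Type*) [Lattice α] (r k : ℕ) : Prop :=
  IsBlock α ∧ IsChain (· ≤ ·) {x : α | IsReducibleElt x} ∧
    {x : α | IsReducibleElt x}.ncard = r ∧ posetNullity α = (k : ℤ)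

/-! ### The basic block associated to a poset -/

/-- `x ∈ Irr(P)`: `x` has at most one lower cover and at most one upper cover in the poset `P`. -/
def IsIrr {P : Type*} [PartialOrder P] (x : P) : Prop :=
  {y : P | y ⋖ x}.Subsingleton ∧ {z : P | x ⋖ z}.Subsingleton

/-- `x ∈ Irr(P)` is retractible if either there are no `y, z ∉ Irr(P)` with `y ⋖ x ⋖ z`, or there
are such `y, z` and the only directed path from `y` to `z` in the cover graph is `y, x, z`. -/
def IsRetractible {P : Type*} [PartialOrder P] (x : P) : Prop :=
  IsIrr x ∧
    ((¬ ∃ y z : P, ¬ IsIrr y ∧ ¬ IsIrr z ∧ y ⋖ x ∧ x ⋖ z) ∨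
      (∃ y z : P, ¬ IsIrr y ∧ ¬ IsIrr z ∧ y ⋖ x ∧ x ⋖ z ∧
        ∀ l : List P, l.IsChain (· ⋖ ·) → l.head? = some y → l.getLast? = some z → l = [y, x, z]))

/-- `x` is a pendant vertex: it has exactly one neighbour in the cover graph. -/
def IsPendant {P : Type*} [PartialOrder P] (x : P) : Prop :=
  ((SimpleGraph.hasse P).neighborSet x).ncard = 1

/-- `T` is obtained from `S` (with the order induced from `P`) by removing one element that is
retractible in `S`. The last element of a poset is never removed. -/
def RetractStep {P : Type*} [PartialOrder P] (S T : Set P) : Prop :=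
  S.Nontrivial ∧ ∃ x : S, IsRetractible x ∧ T = S \ {(x : P)}

/-- `T` is obtained from `S` (with the order induced from `P`) by removing one pendant vertex
of `S`. -/
def PendantStep {P : Type*} [PartialOrder P] (S T : Set P) : Prop :=
  ∃ x : S, IsPendant x ∧ T = S \ {(x : P)}

/-- `S ⊆ P`, with the induced order, is a basic retract associated to `P`: it is obtained from `P`
by successive removal of all the retractible elements. -/
def IsAssocBasicRetract {P : Type*} [PartialOrder P] (S : Set P) : Prop :=
  Relation.ReflTransGen RetractStep Set.univ S ∧ ∀ T : Set P, ¬ RetractStep S T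

/-- `S ⊆ P`, with the induced order, is a basic block associated to `P`: it is obtained from a
basic retract associated to `P` by successive removal of all the pendant vertices. -/
def IsAssocBasicBlockSet {P : Type*} [PartialOrder P] (S : Set P) : Prop :=
  ∃ R : Set P, IsAssocBasicRetract R ∧ Relation.ReflTransGen PendantStep R S ∧
    ∀ T : Set P, ¬ PendantStep S T

/-- The poset `B` is (isomorphic to) the basic block associated to the poset `P`. -/
def IsAssocBasicBlock (B P : Type*) [PartialOrder B] [PartialOrder P] : Prop :=
  ∃ S : Set P, IsAssocBasicBlockSet S ∧ Nonempty (B ≃o S)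

/-- The basic block associated to `P` has height `h`. -/
def HasBasicBlockHeight (P : Type*) [PartialOrder P] (h : ℕ) : Prop :=
  ∃ S : Set P, IsAssocBasicBlockSet S ∧ Order.krullDim S = ((h : ℕ∞) : WithBot ℕ∞)

/-! ### The basic blocks `B₈` and `B₉` -/

/-- The nine elements of `B₈`: a chain `o ⋖ a ⋖ b ⋖ c ⋖ x ⋖ i`, and three further elements with
`o ⋖ c1 ⋖ b`, `a ⋖ c2 ⋖ c`, `c ⋖ c3 ⋖ i`. -/
inductive B8 : Type
  | o | a | b | c | x | i | c1 | c2 | c3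
  deriving DecidableEq

namespace B8

instance : Fintype B8 where
  elems := {o, a, b, c, x, i, c1, c2, c3}
  complete := by intro u; cases u <;> decide

/-- The elements lying above a given element of `B₈`. -/
def above : B8 → List B8
  | o => [o, a, b, c, x, i, c1, c2, c3]
  | a => [a, b, c, x, i, c2, c3]
  | b => [b, c, x, i, c3]
  | c => [c, x, i, c3]
  | x => [x, i]
  | i => [i]
  | c1 => [c1, b, c, x, i, c3]
  | c2 => [c2, c, x, i, c3]
  | c3 => [c3, i]

instance : PartialOrder B8 where
  le u v := v ∈ above u
  le_refl := by decide
  le_trans := by decide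
  le_antisymm := by decide

end B8

/-- The basic block `B₉` is the dual of `B₈`. -/
abbrev B9 : Type := B8ᵒᵈ

/-! ### Lattices on `n` elements up to isomorphism -/

/-- A lattice structure on a set of `n` elements. -/
structure LatticeOn (n : ℕ) where
  lattice : Lattice (Fin n)

namespace LatticeOn

/-- The underlying set of the lattice; its order is `L.lattice`, not the usual order of `Fin n`. -/
def Carrier {n : ℕ} (_L : LatticeOn n) : Type := Fin n

instance {n : ℕ} (L : LatticeOn n) : Lattice L.Carrier := L.lattice

/-- The dual lattice. -/
def dual {n : ℕ} (L : LatticeOn n) : LatticeOn n where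
  lattice := inferInstanceAs (Lattice L.Carrierᵒᵈ)

/-- Isomorphism of lattices. -/
def isoSetoid (n : ℕ) : Setoid (LatticeOn n) where
  r L M := Nonempty (L.Carrier ≃o M.Carrier)
  iseqv :=
    { refl := fun L => ⟨OrderIso.refl L.Carrier⟩
      symm := fun ⟨e⟩ => ⟨e.symm⟩
      trans := fun ⟨e⟩ ⟨f⟩ => ⟨e.trans f⟩ }

end LatticeOn

/-- The number of isomorphism classes of lattices on `n` elements having a property `p`. -/
noncomputable def numIsoClasses (n : ℕ) (p : LatticeOn n → Prop) : ℕ :=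
  {q : Quotient (LatticeOn.isoSetoid n) | ∃ L : LatticeOn n, p L ∧ Quotient.mk _ L = q}.ncard

/-- `L` belongs to the class `𝔹(j; 5, 3)` of the maximal blocks on `j` elements with five
comparable reducible elements and nullity three whose associated basic block is `B`. -/
def InClassWithBasicBlock (B : Type*) [PartialOrder B] {j : ℕ} (L : LatticeOn j) : Prop :=
  IsRCBlock L.Carrier 5 3 ∧ IsAssocBasicBlock B L.Carrier

/-- `L` belongs to the class `𝓑(j; r, k, h)` of the maximal blocks on `j` elements with `r`
comparable reducible elements, nullity `k`, and associated basic block of height `h`. -/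
def InClassWithHeight (r k h : ℕ) {j : ℕ} (L : LatticeOn j) : Prop :=
  IsRCBlock L.Carrier r k ∧ HasBasicBlockHeight L.Carrier h

/-- The vertical sum of `α` (with a greatest element) and `β` (with a least element): the linear
sum of `α` and `β` with the least element of `β` identified with the greatest element of `α`. -/
abbrev VerticalSum (α β : Type*) [Lattice α] [Lattice β] : Type _ :=
  α ⊕ₗ {y : β // ¬ IsBot y}

/-- The number of partitions of the integer `n` into exactly `k` positive parts. -/
def numPartitionsInto (n k : ℕ) : ℕ :=
  (Finset.univ.filter fun p : n.Partition => Multiset.card p.parts = k).card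

/-! In a finite block whose reducible elements form a chain, each element `x` lies between the
nearest reducible elements `dn x ≤ x ≤ up x`. If `x ≤ y`, then either `up x ≤ dn y` or the two are
`Near`, i.e. comparable with the same `dn` and `up` (`RedFrame.le_cases`). Nearness is an
equivalence relation, so the block consists of chains strung between reducible elements, and its
order is determined by the ends and lengths of these chains.

Retraction preserves the reducible elements, the difference between edges and vertices, and the
presence of a representative near every essential element, one having an incomparable element
between its `dn` and `up` (`Inv.step`). When retraction stops, the reducible elements and one
representative of each essential chain remain (`Inv.transversal`), and no vertex is pendant. This
holds for every order of removal, so any associated basic block is such a `Transversal`.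

A `Shape` records a basic block and the gaps into which inessential elements may go; a `Layout`
sends each element to its vertex. The block has type `B₈` exactly when it has a layout of that shape
(`B8.class_iff`). In the same way the classes `𝓑(p; 4, 2, 3)` and `𝓑(q; 2, 1, 2)` are the blocks
laid out on `Hexagon` and `Diamond`: nullity, and for the first one height, leave no other basic
block. Cutting the shape of `B₈` at `c` gives these two shapes, whence the vertical sum.

For the count, a lattice is determined by its fibre sizes. Below `c` there are five free sizes
(three gaps, which may be empty, and the chains of `c1` and `c2`), distinguished by their ends. With
`p` elements up to `c` they share an excess of `p - 6`, in `(p - 2).choose 4` ways. Above `c` the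
chains of `x` and `c3` have the same ends, so only the unordered pair of their sizes matters: a
partition of `j - p - 1` into two parts. The count for `B₉` follows by duality. -/

/-! ### Covers inside a subset and the removal of a retractible element. -/

section Steps

variable {P : Type*} [PartialOrder P]

/-- `v` covers `u` in the subset `S`, with the induced order. -/
def CovIn (S : Set P) (u v : P) : Prop :=
  u ∈ S ∧ v ∈ S ∧ u < v ∧ ∀ w ∈ S, ¬ (u < w ∧ w < v)

/-- The pairs `(u, v)` such that `v` covers `u` in `S`. -/
def covSet (S : Set P) : Set (P × P) := {p | CovIn S p.1 p.2}

/-- `x` has at most one lower cover and at most one upper cover in the subset `S`. -/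
def IrrIn (S : Set P) (x : P) : Prop :=
  (∀ u u', CovIn S u x → CovIn S u' x → u = u') ∧ (∀ v v', CovIn S x v → CovIn S x v' → v = v')

theorem covIn_iff {S : Set P} {u v : S} : CovIn S u v ↔ u ⋖ v := by
  constructor
  · rintro ⟨-, -, h, h'⟩
    exact ⟨h, fun w h1 h2 => h' w w.2 ⟨h1, h2⟩⟩
  · rintro ⟨h, h'⟩
    exact ⟨u.2, v.2, h, fun w hw hh => h' (c := ⟨w, hw⟩) hh.1 hh.2⟩

theorem irrIn_iff {S : Set P} {x : S} : IrrIn S x ↔ IsIrr x := by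
  constructor
  · rintro ⟨h1, h2⟩
    exact ⟨fun y hy z hz => Subtype.ext (h1 _ _ (covIn_iff.2 hy) (covIn_iff.2 hz)),
      fun y hy z hz => Subtype.ext (h2 _ _ (covIn_iff.2 hy) (covIn_iff.2 hz))⟩
  · rintro ⟨h1, h2⟩
    refine ⟨fun u u' hu hu' => ?_, fun u u' hu hu' => ?_⟩
    · exact congrArg Subtype.val (@h1 ⟨u, hu.1⟩ (covIn_iff.1 hu) ⟨u', hu'.1⟩ (covIn_iff.1 hu'))
    · exact congrArg Subtype.val
        (@h2 ⟨u, hu.2.1⟩ (covIn_iff.1 hu) ⟨u', hu'.2.1⟩ (covIn_iff.1 hu'))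

theorem covIn_univ {u v : P} : CovIn Set.univ u v ↔ u ⋖ v :=
  ⟨fun h => ⟨h.2.2.1, fun w h1 h2 => h.2.2.2 w trivial ⟨h1, h2⟩⟩,
    fun h => ⟨trivial, trivial, h.1, fun _ _ hh => h.2 hh.1 hh.2⟩⟩

theorem irrIn_univ {x : P} : IrrIn Set.univ x ↔ IsIrr x := by
  simp only [IrrIn, covIn_univ]
  exact ⟨fun h => ⟨fun y hy z hz => h.1 y z hy hz, fun y hy z hz => h.2 y z hy hz⟩,
    fun h => ⟨fun y z hy hz => h.1 hy hz, fun y z hy hz => h.2 hy hz⟩⟩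

theorem le_of_path {l : List P} {u v : P} (hl : (u :: l).IsChain (· ⋖ ·))
    (hlast : (u :: l).getLast? = some v) : (∀ w ∈ u :: l, u ≤ w ∧ w ≤ v) := by
  induction l generalizing u with
  | nil => simp at hlast; simp [hlast]
  | cons a l ih =>
    have h1 := ih hl.tail (by simpa using hlast)
    have h2 : u ⋖ a := hl.rel
    have h3 := h1 a (by simp)
    intro w hw
    rcases List.mem_cons.1 hw with rfl | hw
    · exact ⟨le_rfl, h2.le.trans h3.2⟩
    · exact ⟨h2.le.trans (h1 w hw).1, (h1 w hw).2⟩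

variable [Finite P]

theorem exists_covIn_up {S : Set P} {u v : P} (hu : u ∈ S) (hv : v ∈ S) (h : u < v) :
    ∃ w, CovIn S u w ∧ w ≤ v := by
  obtain ⟨w, hw, hwv⟩ := exists_covBy_le_of_lt (show (⟨u, hu⟩ : S) < ⟨v, hv⟩ from h)
  exact ⟨w, covIn_iff.2 hw, hwv⟩

theorem exists_covIn_down {S : Set P} {u v : P} (hu : u ∈ S) (hv : v ∈ S) (h : u < v) :
    ∃ w, CovIn S w v ∧ u ≤ w := by
  obtain ⟨w, hwv, hw⟩ := exists_le_covBy_of_lt (show (⟨u, hu⟩ : S) < ⟨v, hv⟩ from h)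
  exact ⟨w, covIn_iff.2 hw, hwv⟩

theorem exists_path {u v : P} (h : u ≤ v) :
    ∃ l : List P, (u :: l).IsChain (· ⋖ ·) ∧ (u :: l).getLast? = some v := by
  classical
  have := Fintype.ofFinite P
  let _ : LocallyFiniteOrder P := @Fintype.toLocallyFiniteOrder P _ _ (Classical.decRel _)
    (Classical.decRel _)
  obtain ⟨l, hl, hlast⟩ := List.exists_isChain_cons_of_relationReflTransGen
    (le_iff_reflTransGen_covBy.1 h)
  exact ⟨l, hl, by rw [List.getLast?_eq_some_getLast (by simp), hlast]⟩

theorem exists_path_through {u w v : P} (h : u ≤ w) (h' : w ≤ v) :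
    ∃ l : List P, l.IsChain (· ⋖ ·) ∧ l.head? = some u ∧ l.getLast? = some v ∧ w ∈ l := by
  obtain ⟨l, hl, hlast⟩ := exists_path h
  obtain ⟨m, hm, hmlast⟩ := exists_path h'
  refine ⟨(u :: l) ++ m, ?_, by simp, ?_, ?_⟩
  · refine List.IsChain.append hl hm.tail ?_
    intro x hx y hy
    rw [hlast] at hx
    obtain rfl : w = x := by simpa using hx
    cases m with
    | nil => simp at hy
    | cons b m => 
      obtain rfl : b = y := by simpa using hy
      simpa using hm.rel
  · cases m with
    | nil => simp_all
    | cons b m =>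
      rw [List.getLast?_append]
      rw [List.getLast?_cons_cons] at hmlast
      simp [hmlast]
  · exact List.mem_append_left _ (List.mem_of_getLast? hlast)

/-- This turns the path condition in retractibility into a condition on the interval from `y` to
`z`, because every element of that interval lies on some directed path. -/
theorem unique_path_iff {y x z : P} (hy : y ⋖ x) (hz : x ⋖ z) :
    (∀ l : List P, l.IsChain (· ⋖ ·) → l.head? = some y → l.getLast? = some z → l = [y, x, z]) ↔
      ∀ w, y ≤ w → w ≤ z → w = y ∨ w = x ∨ w = z := by
  constructor
  · intro h w h1 h2
    obtain ⟨l, hl, hh, hlast, hw⟩ := exists_path_through h1 h2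
    rw [h l hl hh hlast] at hw
    simpa using hw
  · intro h l hl hh hlast
    match l, hl, hh, hlast with
    | [a], _, hh, hlast =>
      have : y = z := by simp_all
      exact absurd this (hy.lt.trans hz.lt).ne
    | a :: b :: l, hl, hh, hlast =>
      obtain rfl : a = y := by simpa using hh
      have hab : a ⋖ b := hl.rel
      have hb := le_of_path hl.tail (by simpa using hlast)
      have hbx : b = x := by
        rcases h b hab.le (hb b (by simp)).2 with h1 | h1 | h1
        · exact absurd h1 hab.lt.ne'
        · exact h1
        · exact absurd hz.lt (fun h => hab.2 hy.lt (h1 ▸ h))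
      subst hbx
      match l, hl, hlast, hb with
      | [], _, hlast, _ =>
        have : b = z := by simpa using hlast
        exact absurd this hz.lt.ne
      | c :: l, hl, hlast, hb =>
        have hbc : b ⋖ c := hl.tail.rel
        have hc := le_of_path hl.tail.tail (by simpa using hlast)
        have hcz : c = z := by
          rcases h c (hab.le.trans hbc.le) (hc c (by simp)).2 with h1 | h1 | h1
          · exact absurd (hab.lt.trans hbc.lt) (by simp [h1])
          · exact absurd h1 hbc.lt.ne'
          · exact h1
        subst hcz
        match l, hl, hlast, hc with
        | [], _, _, _ => rfl
        | d :: l, hl, _, hc =>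
          have hcd : c ⋖ d := hl.tail.tail.rel
          exact absurd (hcd.lt.trans_le (hc d (by simp)).2) (lt_irrefl _)

/-- A retractible element of `S` is the only element strictly between its two covers. -/
theorem IsRetractible.interval {S : Set P} {x : S} (hx : IsRetractible x) {y z : P}
    (hy : CovIn S y x) (hz : CovIn S x z) {w : P} (hw : w ∈ S) (h1 : y ≤ w) (h2 : w ≤ z) :
    w = y ∨ w = x ∨ w = z := by
  have hirr := irrIn_iff.2 hx.1
  -- If `y` is irreducible in `S`, then `x` is its only upper cover, so all of `S` above `y` passes
  -- through `x` and then through `z`. Dually for `z`. If neither is irreducible, the second clause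
  -- of retractibility must apply.
  by_cases hyI : IrrIn S y
  · rcases h1.eq_or_lt with h1 | h1
    · exact .inl h1.symm
    obtain ⟨u, hu, huw⟩ := exists_covIn_up hy.1 hw h1
    obtain rfl := hyI.2 _ _ hy hu
    rcases huw.eq_or_lt with h3 | h3
    · exact .inr (.inl h3.symm)
    obtain ⟨u, hu, huw⟩ := exists_covIn_up hy.2.1 hw h3
    obtain rfl := hirr.2 _ _ hz hu
    exact .inr (.inr (le_antisymm h2 huw))
  by_cases hzI : IrrIn S z
  · rcases h2.eq_or_lt with h2 | h2
    · exact .inr (.inr h2)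
    obtain ⟨u, hu, huw⟩ := exists_covIn_down hw hz.2.1 h2
    obtain rfl := hzI.1 _ _ hz hu
    rcases huw.eq_or_lt with h3 | h3
    · exact .inr (.inl h3)
    obtain ⟨u, hu, huw⟩ := exists_covIn_down hw hy.2.1 h3
    obtain rfl := hirr.1 _ _ hy hu
    exact .inl (le_antisymm huw h1)
  lift y to S using hy.1
  lift z to S using hz.2.1
  lift w to S using hw
  rw [irrIn_iff] at hyI hzI
  rw [covIn_iff] at hy hz
  rcases hx.2 with h | ⟨y', z', -, -, hy', hz', h⟩
  · exact absurd ⟨y, z, hyI, hzI, hy, hz⟩ h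
  · obtain rfl := hx.1.1 hy hy'
    obtain rfl := hx.1.2 hz hz'
    have := (unique_path_iff hy hz).1 h w h1 h2
    simpa only [Subtype.ext_iff] using this

section Remove

variable {S : Set P} {x y z : P} (hirr : IrrIn S x) (hy : CovIn S y x) (hz : CovIn S x z)
  (hint : ∀ w ∈ S, y ≤ w → w ≤ z → w = y ∨ w = x ∨ w = z)

include hirr hy hz hint

/-- Removing `x` replaces the path `y, x, z` by a single edge; by `hint` nothing else separates `y`
from `z`. -/
theorem covIn_remove {u v : P} : CovIn (S \ {x}) u v ↔
    (CovIn S u v ∧ u ≠ x ∧ v ≠ x) ∨ (u = y ∧ v = z) := by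
  have hyx := hy.2.2.1
  have hxz := hz.2.2.1
  constructor
  · rintro ⟨⟨hu, hux⟩, ⟨hv, hvx⟩, huv, h⟩
    by_cases hx : u < x ∧ x < v
    · right
      obtain ⟨w, hw, huw⟩ := exists_covIn_down hu hy.2.1 hx.1
      obtain rfl := hirr.1 _ _ hy hw
      obtain ⟨w', hw', huw'⟩ := exists_covIn_up hy.2.1 hv hx.2
      obtain rfl := hirr.2 _ _ hz hw'
      constructor
      · by_contra hne
        exact h y ⟨hy.1, hyx.ne⟩ ⟨huw.lt_of_ne hne, hyx.trans hx.2⟩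
      · by_contra hne
        exact h z ⟨hz.2.1, hxz.ne'⟩ ⟨hx.1.trans hxz, huw'.lt_of_ne (Ne.symm hne)⟩
    · refine .inl ⟨⟨hu, hv, huv, fun w hw hh => ?_⟩, hux, hvx⟩
      by_cases hwx : w = x
      · exact hx (hwx ▸ hh)
      · exact h w ⟨hw, hwx⟩ hh
  · rintro (⟨⟨hu, hv, huv, h⟩, hux, hvx⟩ | ⟨rfl, rfl⟩)
    · exact ⟨⟨hu, hux⟩, ⟨hv, hvx⟩, huv, fun w hw => h w hw.1⟩
    · refine ⟨⟨hy.1, hyx.ne⟩, ⟨hz.2.1, hxz.ne'⟩, hyx.trans hxz, fun w hw hh => ?_⟩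
      rcases hint w hw.1 hh.1.le hh.2.le with rfl | rfl | rfl
      · exact lt_irrefl _ hh.1
      · exact hw.2 rfl
      · exact lt_irrefl _ hh.2

/-- Only `y` and `z` are affected: `y` exchanges the upper cover `x` for `z`, and `z` exchanges the
lower cover `x` for `y`. The exchange creates no coincidence, as `z` did not cover `y` before. -/
theorem irrIn_remove {u : P} (hu : u ≠ x) : IrrIn (S \ {x}) u ↔ IrrIn S u := by
  have hyz : ¬ CovIn S y z := fun h => h.2.2.2 x hy.2.1 ⟨hy.2.2.1, hz.2.2.1⟩
  have h1 := hirr.1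
  have h2 := hirr.2
  have hc := @covIn_remove _ _ _ S x y z hirr hy hz hint
  have hxz := hz.2.2.1.ne
  have hyx := hy.2.2.1.ne
  simp only [IrrIn, hc]
  refine and_congr ⟨fun h v v' hv hv' => ?_, fun h v v' hv hv' => ?_⟩
    ⟨fun h v v' hv hv' => ?_, fun h v v' hv hv' => ?_⟩ <;> grind

/-- Two edges become one while one vertex disappears, so the nullity is unchanged. -/
theorem ncard_covSet_remove : (covSet (S \ {x})).ncard + 1 = (covSet S).ncard := by
  have h1 : covSet (S \ {x}) = insert (y, z) ((covSet S \ {(y, x)}) \ {(x, z)}) := by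
    have h1 := hirr.1
    have h2 := hirr.2
    have hc := @covIn_remove _ _ _ S x y z hirr hy hz hint
    ext ⟨u, v⟩
    simp only [covSet, Set.mem_ofPred_eq, hc, Set.mem_insert_iff, Set.mem_sdiff,
      Set.mem_singleton_iff, Prod.mk.injEq]
    grind
  have hyz : ¬ CovIn S y z := fun h => h.2.2.2 x hy.2.1 ⟨hy.2.2.1, hz.2.2.1⟩
  rw [h1, Set.ncard_insert_of_notMem (fun h => hyz h.1.1)]
  have h2 : (x, z) ∈ covSet S \ {(y, x)} :=
    ⟨hz, fun h => hy.2.2.1.ne' (congrArg Prod.fst h)⟩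
  rw [Set.ncard_sdiff_singleton_add_one h2,
    Set.ncard_sdiff_singleton_add_one (show (y, x) ∈ covSet S from hy)]

end Remove

end Steps

/-! ### The chain of reducible elements and the chains strung between them. -/

section Frame

theorem isReducibleElt_iff {α : Type*} [Lattice α] [Finite α] {x : α} :
    IsReducibleElt x ↔ ¬ IsIrr x := by
  constructor
  · rintro (⟨y, z, hy, hz, h⟩ | ⟨y, z, hy, hz, h⟩) ⟨h1, h2⟩
    · obtain ⟨u, hyu, hu⟩ := exists_le_covBy_of_lt ((h ▸ le_sup_left : y ≤ x).lt_of_ne hy)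
      obtain ⟨v, hzv, hv⟩ := exists_le_covBy_of_lt ((h ▸ le_sup_right : z ≤ x).lt_of_ne hz)
      obtain rfl := h1 hu hv
      exact absurd (h ▸ sup_le hyu hzv) hu.lt.not_ge
    · obtain ⟨u, hu, hyu⟩ := exists_covBy_le_of_lt ((h ▸ inf_le_left : x ≤ y).lt_of_ne hy.symm)
      obtain ⟨v, hv, hzv⟩ := exists_covBy_le_of_lt ((h ▸ inf_le_right : x ≤ z).lt_of_ne hz.symm)
      obtain rfl := h2 hu hv
      exact absurd (h ▸ le_inf hyu hzv) hu.lt.not_ge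
  · intro h
    rw [IsIrr, not_and_or, Set.not_subsingleton_iff, Set.not_subsingleton_iff] at h
    rcases h with ⟨y, hy, z, hz, hyz⟩ | ⟨y, hy, z, hz, hyz⟩
    · exact .inl ⟨y, z, CovBy.ne hy, CovBy.ne hz, CovBy.wcovBy hy |>.sup_eq (CovBy.wcovBy hz) hyz⟩
    · exact .inr ⟨y, z, CovBy.ne' hy, CovBy.ne' hz, CovBy.wcovBy hy |>.inf_eq (CovBy.wcovBy hz) hyz⟩

variable {α : Type*} [Lattice α]

theorem isReducibleElt_sup {x y : α} (h : ¬ x ≤ y) (h' : ¬ y ≤ x) : IsReducibleElt (x ⊔ y) :=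
  .inl ⟨x, y, fun e => h' (e ▸ le_sup_right), fun e => h (e ▸ le_sup_left), rfl⟩

theorem isReducibleElt_inf {x y : α} (h : ¬ x ≤ y) (h' : ¬ y ≤ x) : IsReducibleElt (x ⊓ y) :=
  .inr ⟨x, y, fun e => h (e ▸ inf_le_right), fun e => h' (e ▸ inf_le_left), rfl⟩

/-- Every element `x` lies between a greatest reducible element `dn x ≤ x` and a least reducible
element `up x ≥ x`. -/
structure RedFrame (α : Type*) [Lattice α] where
  dn : α → α
  up : α → α
  dn_red : ∀ x, IsReducibleElt (dn x)
  up_red : ∀ x, IsReducibleElt (up x)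
  dn_le : ∀ x, dn x ≤ x
  le_up : ∀ x, x ≤ up x
  le_dn : ∀ {r x}, IsReducibleElt r → r ≤ x → r ≤ dn x
  up_le : ∀ {x r}, IsReducibleElt r → x ≤ r → up x ≤ r

theorem exists_redFrame [Finite α] (h : IsBlock α)
    (hc : IsChain (· ≤ ·) {x : α | IsReducibleElt x}) : Nonempty (RedFrame α) := by
  obtain ⟨⟨b, hb, hbr⟩, t, ht, htr⟩ := h
  have tot : ∀ {r s : α}, IsReducibleElt r → IsReducibleElt s → r ≤ s ∨ s ≤ r :=
    fun hr hs => hc.total hr hs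
  have h1 : ∀ x : α, ∃ d, IsReducibleElt d ∧ d ≤ x ∧ ∀ r, IsReducibleElt r → r ≤ x → r ≤ d := by
    intro x
    obtain ⟨d, hd⟩ := (Set.toFinite {r : α | IsReducibleElt r ∧ r ≤ x}).exists_maximal
      ⟨b, hbr, hb x⟩
    refine ⟨d, hd.1.1, hd.1.2, fun r hr hrx => ?_⟩
    rcases tot hr hd.1.1 with h | h
    · exact h
    · exact hd.2 ⟨hr, hrx⟩ h
  have h2 : ∀ x : α, ∃ d, IsReducibleElt d ∧ x ≤ d ∧ ∀ r, IsReducibleElt r → x ≤ r → d ≤ r := by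
    intro x
    obtain ⟨d, hd⟩ := (Set.toFinite {r : α | IsReducibleElt r ∧ x ≤ r}).exists_minimal
      ⟨t, htr, ht x⟩
    refine ⟨d, hd.1.1, hd.1.2, fun r hr hrx => ?_⟩
    rcases tot hr hd.1.1 with h | h
    · exact hd.2 ⟨hr, hrx⟩ h
    · exact h
  choose d hd using h1
  choose u hu using h2
  exact ⟨⟨d, u, fun x => (hd x).1, fun x => (hu x).1, fun x => (hd x).2.1, fun x => (hu x).2.1,
    fun h h' => (hd _).2.2 _ h h', fun h h' => (hu _).2.2 _ h h'⟩⟩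

namespace RedFrame

variable (F : RedFrame α)

/-- `x` and `y` are comparable and lie between the same reducible elements. -/
def Near (x y : α) : Prop := (x ≤ y ∨ y ≤ x) ∧ F.dn x = F.dn y ∧ F.up x = F.up y

/-- Some element between `dn x` and `up x` is incomparable to `x`. -/
def Ess (x : α) : Prop := ∃ w, F.dn x ≤ w ∧ w ≤ F.up x ∧ ¬ w ≤ x ∧ ¬ x ≤ w

variable {F} {x y z r : α}

theorem dn_eq (h : IsReducibleElt r) : F.dn r = r := le_antisymm (F.dn_le r) (F.le_dn h le_rfl)

theorem up_eq (h : IsReducibleElt r) : F.up r = r := le_antisymm (F.up_le h le_rfl) (F.le_up r)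

theorem dn_mono (h : x ≤ y) : F.dn x ≤ F.dn y := F.le_dn (F.dn_red x) ((F.dn_le x).trans h)

theorem up_mono (h : x ≤ y) : F.up x ≤ F.up y := F.up_le (F.up_red y) (h.trans (F.le_up y))

theorem dn_le_up : F.dn x ≤ F.up x := (F.dn_le x).trans (F.le_up x)

theorem red_of_dn_eq (h : F.dn x = F.up x) : IsReducibleElt x :=
  le_antisymm (F.dn_le x) (h ▸ F.le_up x) ▸ F.dn_red x

theorem dn_lt (h : ¬ IsReducibleElt x) : F.dn x < x :=
  (F.dn_le x).lt_of_ne fun e => h (e ▸ F.dn_red x)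

theorem lt_up (h : ¬ IsReducibleElt x) : x < F.up x :=
  (F.le_up x).lt_of_ne fun e => h (e ▸ F.up_red x)

theorem Near.refl : F.Near x x := ⟨.inl le_rfl, rfl, rfl⟩

theorem Near.symm (h : F.Near x y) : F.Near y x := ⟨h.1.symm, h.2.1.symm, h.2.2.symm⟩

theorem Near.eq (h : F.Near x y) (hr : IsReducibleElt x) : y = x := by
  have h1 := h.2.1
  have h2 := h.2.2
  rw [dn_eq hr] at h1
  rw [up_eq hr] at h2
  exact le_antisymm (h2 ▸ F.le_up y) (h1 ▸ F.dn_le y)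

theorem Near.red_iff (h : F.Near x y) : IsReducibleElt x ↔ IsReducibleElt y :=
  ⟨fun hr => h.eq hr ▸ hr, fun hr => h.symm.eq hr ▸ hr⟩

/-- Were `x` and `z` incomparable and on the same side of `y`, their join or meet would be a
reducible element between `x` and `y`. This forces `dn x = up x`, so `x` is reducible and near only
itself. -/
theorem Near.trans (h : F.Near x y) (h' : F.Near y z) : F.Near x z := by
  refine ⟨?_, h.2.1.trans h'.2.1, h.2.2.trans h'.2.2⟩
  by_contra hne
  rw [not_or] at hne
  have key : ∀ {s}, IsReducibleElt s → x ≤ s → s ≤ y → IsReducibleElt x := fun hs h1 h2 =>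
    red_of_dn_eq (le_antisymm dn_le_up (h.2.1 ▸ (F.up_le hs h1).trans (F.le_dn hs h2)))
  have key' : ∀ {s}, IsReducibleElt s → y ≤ s → s ≤ x → IsReducibleElt x := fun hs h1 h2 =>
    red_of_dn_eq (le_antisymm dn_le_up (h.2.2 ▸ (F.up_le hs h1).trans (F.le_dn hs h2)))
  have hx : ¬ IsReducibleElt x := fun hr => by
    have h1 := h.eq hr
    subst h1
    have h2 := h'.eq hr
    subst h2
    exact hne.1 le_rfl
  rcases h.1 with h1 | h1 <;> rcases h'.1 with h2 | h2
  · exact hne.1 (h1.trans h2)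
  · exact hx (key (isReducibleElt_sup hne.1 hne.2) le_sup_left (sup_le h1 h2))
  · exact hx (key' (isReducibleElt_inf hne.1 hne.2) (le_inf h1 h2) inf_le_left)
  · exact hne.2 (h2.trans h1)

/-- The structural dichotomy behind everything else. If no reducible element lies between `x` and
`y`, then `dn y ≤ x`, since otherwise `x ⊔ dn y` would be one; dually `y ≤ up x`. -/
theorem le_cases (h : x ≤ y) : F.up x ≤ F.dn y ∨ F.Near x y := by
  by_contra! hne
  obtain ⟨h1, h2⟩ := hne
  have h3 : ∀ s, IsReducibleElt s → x ≤ s → s ≤ y → False := fun s hs hx hy =>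
    h1 ((F.up_le hs hx).trans (F.le_dn hs hy))
  refine h2 ⟨.inl h, le_antisymm (dn_mono h) ?_, le_antisymm (up_mono h) ?_⟩
  · refine F.le_dn (F.dn_red y) ?_
    by_contra hn
    by_cases hx : x ≤ F.dn y
    · exact h3 _ (F.dn_red y) hx (F.dn_le y)
    · exact h3 _ (isReducibleElt_sup hx hn) le_sup_left (sup_le h (F.dn_le y))
  · refine F.up_le (F.up_red x) ?_
    by_contra hn
    by_cases hx : F.up x ≤ y
    · exact h3 _ (F.up_red x) (F.le_up x) hx
    · exact h3 _ (isReducibleElt_inf hn hx) (le_inf h (F.le_up x)) inf_le_left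

theorem le_of_up_le_dn (h : F.up x ≤ F.dn y) : x ≤ y := (F.le_up x).trans (h.trans (F.dn_le y))

theorem Ess.not_red (h : F.Ess x) : ¬ IsReducibleElt x := by
  intro hr
  obtain ⟨w, h1, h2, h3, -⟩ := h
  exact h3 (up_eq hr ▸ h2)

theorem Near.ess (h : F.Near x y) (hx : F.Ess x) : F.Ess y := by
  obtain ⟨w, h1, h2, h3, h4⟩ := hx
  have hw : ¬ F.Near w x := fun hn => hn.1.elim h3 h4
  refine ⟨w, h.2.1 ▸ h1, h.2.2 ▸ h2, fun hc => ?_, fun hc => ?_⟩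
  · rcases F.le_cases hc with h5 | h5
    · exact h3 (F.le_of_up_le_dn (h.2.1 ▸ h5))
    · exact hw (h5.trans h.symm)
  · rcases F.le_cases hc with h5 | h5
    · exact h4 (F.le_of_up_le_dn (h.2.2 ▸ h5))
    · exact hw (h5.symm.trans h.symm)

end RedFrame

end Frame

/-! ### What retraction preserves and where it stops. -/

namespace RedFrame

variable {α : Type*} [Lattice α] {F : RedFrame α}

/-- Keeps the subsets nontrivial, so the rule sparing the last element never blocks a retraction. -/
theorem exists_red_ne (F : RedFrame α) {r : α} (hr : IsReducibleElt r) :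
    ∃ s, IsReducibleElt s ∧ s ≠ r := by
  by_contra! h
  have key : ∀ y, y = r := fun y =>
    le_antisymm (h _ (F.up_red y) ▸ F.le_up y) (h _ (F.dn_red y) ▸ F.dn_le y)
  rcases hr with ⟨y, -, hy, -⟩ | ⟨y, -, hy, -⟩ <;> exact hy (key y)

variable (F) in
/-- The property of subsets that is preserved by the removal of retractible elements. -/
structure Inv (S : Set α) : Prop where
  red_mem : ∀ x, IsReducibleElt x → x ∈ S
  irr : ∀ x ∈ S, IrrIn S x ↔ ¬ IsReducibleElt x
  ex : ∀ x, F.Ess x → ∃ y ∈ S, F.Near y x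
  card : (covSet S).ncard + Nat.card α = (covSet (Set.univ : Set α)).ncard + S.ncard

variable (F) in
/-- `S` consists of the reducible elements and of one element near each essential element. -/
structure Transversal (S : Set α) : Prop extends Inv F S where
  ess : ∀ x ∈ S, ¬ IsReducibleElt x → F.Ess x
  inj : ∀ x ∈ S, ∀ y ∈ S, F.Near x y → x = y

variable [Finite α] {S T : Set α}

theorem inv_univ : F.Inv Set.univ where
  red_mem _ _ := trivial
  irr x _ := by rw [irrIn_univ, isReducibleElt_iff, not_not]
  ex x _ := ⟨x, trivial, Near.refl⟩
  card := by rw [Set.ncard_univ]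

theorem Inv.exists_cov (h : F.Inv S) {x : α} (hx : x ∈ S) (hr : ¬ IsReducibleElt x) :
    ∃ y z, CovIn S y x ∧ CovIn S x z ∧ F.dn x ≤ y ∧ z ≤ F.up x := by
  obtain ⟨y, hy, hy'⟩ := exists_covIn_down (h.red_mem _ (F.dn_red x)) hx (dn_lt hr)
  obtain ⟨z, hz, hz'⟩ := exists_covIn_up hx (h.red_mem _ (F.up_red x)) (lt_up hr)
  exact ⟨y, z, hy, hz, hy', hz'⟩

/-- The delicate point is that the last representative `s` of an essential chain is never
retractible. A witness `v` of essentiality would itself need a representative in the interval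
between the covers of `s`, and that interval has no room for it. -/
theorem Inv.step (h : F.Inv S) (hST : RetractStep S T) : F.Inv T := by
  obtain ⟨-, ⟨x, hxS⟩, hx, rfl⟩ := hST
  have hirr : IrrIn S x := irrIn_iff.2 hx.1
  have hr : ¬ IsReducibleElt x := (h.irr x hxS).1 hirr
  obtain ⟨y, z, hy, hz, hdy, hzu⟩ := h.exists_cov hxS hr
  have hint : ∀ w ∈ S, y ≤ w → w ≤ z → w = y ∨ w = x ∨ w = z := fun w hw h1 h2 =>
    hx.interval hy hz hw h1 h2
  refine ⟨fun r hr' => ⟨h.red_mem r hr', fun e => hr ((show r = x from e) ▸ hr')⟩, fun u hu => ?_, fun w hw => ?_, ?_⟩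
  · rw [irrIn_remove hirr hy hz hint hu.2, h.irr u hu.1]
  · by_contra! hno
    obtain ⟨s, hs, hsw⟩ := h.ex w hw
    have hsx : s = x := by
      by_contra hne
      exact hno s ⟨hs, hne⟩ hsw
    subst hsx
    have huniq : ∀ t ∈ S, F.Near t s → t = s := fun t ht hts => by
      by_contra hne
      exact hno t ⟨ht, hne⟩ (hts.trans hsw)
    -- The lower cover of `s` is not near `s`, by uniqueness of the representative, so the dichotomy
    -- places it at `dn s`; likewise the upper cover is `up s`.
    have hyd : y = F.dn s := by
      rcases F.le_cases hy.2.2.1.le with h1 | h1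
      · exact le_antisymm ((F.le_up y).trans h1) hdy
      · exact absurd (huniq y hy.1 h1) hy.2.2.1.ne
    have hzd : z = F.up s := by
      rcases F.le_cases hz.2.2.1.le with h1 | h1
      · exact le_antisymm hzu (h1.trans (F.dn_le z))
      · exact absurd (huniq z hz.2.1 h1.symm) hz.2.2.1.ne'
    subst hyd hzd
    obtain ⟨v, hv1, hv2, hv3, hv4⟩ := hsw.symm.ess hw
    -- The reducible elements next to `v` are in `S`, hence in the three-element interval around
    -- `s`; so `v` has the same ends as `s` and is essential in turn.
    have hup : F.up v = F.up s := by
      rcases hint (F.up v) (h.red_mem _ (F.up_red v)) (hv1.trans (F.le_up v))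
        (F.up_le (F.up_red s) hv2) with h1 | h1 | h1
      · exact absurd ((F.le_up v).trans (h1 ▸ F.dn_le s)) hv3
      · exact absurd (h1 ▸ F.up_red v) hr
      · exact h1
    have hdn : F.dn v = F.dn s := by
      rcases hint (F.dn v) (h.red_mem _ (F.dn_red v)) (F.le_dn (F.dn_red s) hv1)
        ((F.dn_le v).trans hv2) with h1 | h1 | h1
      · exact h1
      · exact absurd (h1 ▸ F.dn_red v) hr
      · exact absurd ((h1 ▸ F.le_up s).trans (F.dn_le v)) hv4
    have hev : F.Ess v := ⟨s, hdn ▸ F.dn_le s, hup ▸ F.le_up s, hv4, hv3⟩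
    obtain ⟨t, ht, htv⟩ := h.ex v hev
    have htr : ¬ IsReducibleElt t := fun hh => hev.not_red (htv.red_iff.1 hh)
    rcases hint t ht (hdn ▸ htv.2.1 ▸ F.dn_le t) (hup ▸ htv.2.2 ▸ F.le_up t) with h1 | h1 | h1
    · exact htr (h1 ▸ F.dn_red s)
    · subst h1
      exact htv.1.elim hv4 hv3
    · exact htr (h1 ▸ F.up_red s)
  · have h1 := ncard_covSet_remove hirr hy hz hint
    have h2 := Set.ncard_sdiff_singleton_add_one hxS (Set.toFinite S)
    have h3 := h.card
    simp only at *
    omega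

theorem Inv.of_reflTransGen (h : F.Inv S) (hST : Relation.ReflTransGen RetractStep S T) :
    F.Inv T := by
  induction hST with
  | refl => exact h
  | tail _ h1 ih => exact ih.step h1

/-- An irreducible element left over when no retraction is possible has reducible covers, which must
be `dn x` and `up x`, and a further element of `S` between them. The latter witnesses essentiality;
the former excludes two near elements of `S`. -/
theorem Inv.transversal (h : F.Inv S) (hS : ∀ T, ¬ RetractStep S T) : F.Transversal S := by
  have hnt : ∀ x ∈ S, S.Nontrivial := fun x _ => by
    obtain ⟨s, hs, hne⟩ := F.exists_red_ne (F.dn_red x)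
    exact ⟨s, h.red_mem _ hs, _, h.red_mem _ (F.dn_red x), hne⟩
  have key : ∀ x ∈ S, ¬ IsReducibleElt x → CovIn S (F.dn x) x ∧ CovIn S x (F.up x) ∧
      ∃ w ∈ S, F.dn x ≤ w ∧ w ≤ F.up x ∧ w ≠ F.dn x ∧ w ≠ x ∧ w ≠ F.up x := by
    intro x hx hr
    have hirr := (h.irr x hx).2 hr
    have hnr : ¬ IsRetractible (⟨x, hx⟩ : S) := fun hh => hS _ ⟨hnt x hx, ⟨x, hx⟩, hh, rfl⟩
    rw [IsRetractible, not_and, not_or, not_not] at hnr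
    obtain ⟨⟨y, z, hyI, hzI, hy, hz⟩, hn⟩ := hnr (irrIn_iff.1 hirr)
    obtain ⟨y', z', hy', hz', hdy, hzu⟩ := h.exists_cov hx hr
    have hyc := covIn_iff.2 hy
    have hzc := covIn_iff.2 hz
    obtain rfl := hirr.1 _ _ hyc hy'
    obtain rfl := hirr.2 _ _ hzc hz'
    have hyr : IsReducibleElt (y : α) := by
      rw [← irrIn_iff, h.irr _ y.2, not_not] at hyI
      exact hyI
    have hzr : IsReducibleElt (z : α) := by
      rw [← irrIn_iff, h.irr _ z.2, not_not] at hzI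
      exact hzI
    have hyd : (y : α) = F.dn x := le_antisymm (F.le_dn hyr hyc.2.2.1.le) hdy
    have hzd : (z : α) = F.up x := le_antisymm hzu (F.up_le hzr hzc.2.2.1.le)
    refine ⟨hyd ▸ hyc, hzd ▸ hzc, ?_⟩
    have hn' : ¬ ∀ w : S, y ≤ w → w ≤ z → w = y ∨ w = ⟨x, hx⟩ ∨ w = z := fun hh =>
      hn ⟨y, z, hyI, hzI, hy, hz, (unique_path_iff hy hz).2 hh⟩
    push Not at hn'
    obtain ⟨w, h1, h2, h3, h4, h5⟩ := hn'
    rw [← hyd, ← hzd]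
    exact ⟨w, w.2, h1, h2, fun e => h3 (Subtype.ext e), fun e => h4 (Subtype.ext e),
      fun e => h5 (Subtype.ext e)⟩
  have ninj : ∀ x ∈ S, ∀ y ∈ S, F.Near x y → ¬ x < y := by
    intro x hx y hy hxy hlt
    have hr : ¬ IsReducibleElt x := fun hr => hlt.ne' (hxy.eq hr)
    obtain ⟨-, hc, -⟩ := key x hx hr
    obtain ⟨z, hz, hzy⟩ := exists_covIn_up hx hy hlt
    obtain rfl := ((h.irr x hx).2 hr).2 _ _ hz hc
    exact hr (red_of_dn_eq (le_antisymm dn_le_up (hxy.2.1 ▸ F.le_dn (F.up_red x) hzy)))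
  refine { h with ess := fun x hx hr => ?_, inj := fun x hx y hy hxy => ?_ }
  · obtain ⟨h1, h2, w, hw, h3, h4, h5, h6, h7⟩ := key x hx hr
    have hirr := (h.irr x hx).2 hr
    refine ⟨w, h3, h4, fun hwx => ?_, fun hwx => ?_⟩
    · obtain ⟨y, hy, hwy⟩ := exists_covIn_down hw hx (hwx.lt_of_ne h6)
      obtain rfl := hirr.1 _ _ h1 hy
      exact h5 (le_antisymm hwy h3)
    · obtain ⟨y, hy, hwy⟩ := exists_covIn_up hx hw (hwx.lt_of_ne h6.symm)
      obtain rfl := hirr.2 _ _ h2 hy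
      exact h7 (le_antisymm h4 hwy)
  · by_contra hne
    rcases hxy.1 with h1 | h1
    · exact ninj x hx y hy hxy (h1.lt_of_ne hne)
    · exact ninj y hy x hx hxy.symm (h1.lt_of_ne (Ne.symm hne))

/-- A reducible element keeps two covers on one side, and an irreducible one has a cover on each
side, so every degree is at least two. -/
theorem Inv.not_pendantStep (h : F.Inv S) : ¬ PendantStep S T := by
  rintro ⟨x, hx, -⟩
  obtain ⟨a, ha⟩ := Set.ncard_eq_one.1 hx
  have key : ∀ y : S, y ⋖ x ∨ x ⋖ y → y = a := fun y hy => by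
    have : y ∈ (SimpleGraph.hasse S).neighborSet x := hy.symm
    rw [ha] at this
    exact this
  by_cases hr : IsReducibleElt (x : α)
  · have hI : ¬ IsIrr x := by
      rw [← irrIn_iff, h.irr _ x.2, not_not]
      exact hr
    exact hI ⟨fun y hy z hz => (key y (.inl hy)).trans (key z (.inl hz)).symm,
      fun y hy z hz => (key y (.inr hy)).trans (key z (.inr hz)).symm⟩
  · obtain ⟨y, z, hy, hz, -⟩ := h.exists_cov x.2 hr
    have h1 := key ⟨y, hy.1⟩ (.inl (covIn_iff.1 hy))
    have h2 := key ⟨z, hz.2.1⟩ (.inr (covIn_iff.1 hz))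
    have h3 : y = z := congrArg Subtype.val (h1.trans h2.symm)
    exact (hy.2.2.1.trans hz.2.2.1).ne h3

theorem transversal_of_isAssocBasicBlockSet (F : RedFrame α) (h : IsAssocBasicBlockSet S) :
    F.Transversal S := by
  obtain ⟨R, ⟨hR, hR'⟩, hRS, -⟩ := h
  have hI : F.Inv R := inv_univ.of_reflTransGen hR
  rcases hRS.cases_head with rfl | ⟨T, hT, -⟩
  · exact hI.transversal hR'
  · exact absurd hT hI.not_pendantStep

theorem exists_isAssocBasicBlockSet (F : RedFrame α) : ∃ S : Set α, IsAssocBasicBlockSet S := by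
  obtain ⟨S, hS⟩ := (Set.toFinite {S : Set α | Relation.ReflTransGen RetractStep Set.univ S}
    ).exists_minimal ⟨Set.univ, .refl⟩
  have hI : F.Inv S := inv_univ.of_reflTransGen hS.1
  refine ⟨S, S, ⟨hS.1, fun T hT => ?_⟩, .refl, fun T => hI.not_pendantStep⟩
  have h1 : T ≤ S := by
    obtain ⟨-, x, -, rfl⟩ := hT
    exact Set.sdiff_subset
  have h2 : S ≤ T := hS.2 (Relation.ReflTransGen.tail hS.1 hT) h1
  obtain ⟨-, x, -, rfl⟩ := hT
  exact (h2 x.2).2 rfl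

end RedFrame

/-! ### Nullity read off from a retract. -/

section Nullity

theorem ncard_edgeSet_hasse (α : Type*) [PartialOrder α] :
    (SimpleGraph.hasse α).edgeSet.ncard = (covSet (Set.univ : Set α)).ncard := by
  have h : (SimpleGraph.hasse α).edgeSet =
      (fun p : α × α => s(p.1, p.2)) '' covSet (Set.univ : Set α) := by
    ext e
    induction e with
    | _ u v =>
      simp only [SimpleGraph.mem_edgeSet, SimpleGraph.hasse_adj, Set.mem_image, Prod.exists,
        Sym2.eq_iff, covSet, Set.mem_ofPred_eq, covIn_univ]
      constructor
      · rintro (h | h)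
        · exact ⟨u, v, h, .inl ⟨rfl, rfl⟩⟩
        · exact ⟨v, u, h, .inr ⟨rfl, rfl⟩⟩
      · rintro ⟨a, b, h, ⟨rfl, rfl⟩ | ⟨rfl, rfl⟩⟩
        · exact .inl h
        · exact .inr h
  rw [h, Set.InjOn.ncard_image]
  rintro ⟨a, b⟩ hab ⟨c, d⟩ hcd h
  rcases Sym2.eq_iff.1 h with ⟨h1, h2⟩ | ⟨h1, h2⟩
  · exact Prod.ext h1 h2
  · have h3 : a < b := hab.2.2.1
    have h4 : c < d := hcd.2.2.1
    simp only at h1 h2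
    rw [h1, h2] at h3
    exact absurd h3 h4.not_gt

theorem reachable_hasse_of_le {α : Type*} [PartialOrder α] [Finite α] {x y : α} (h : x ≤ y) :
    (SimpleGraph.hasse α).Reachable x y := by
  obtain ⟨l, hl, hlast⟩ := exists_path h
  clear h
  induction l generalizing x with
  | nil => simp at hlast; subst hlast; rfl
  | cons a l ih =>
    exact (SimpleGraph.Adj.reachable (SimpleGraph.hasse_adj.2 (.inl hl.rel))).trans (ih hl.tail (by simpa using hlast))

theorem posetNullity_eq (α : Type*) [Lattice α] [Finite α] [Nonempty α] :
    posetNullity α = (covSet (Set.univ : Set α)).ncard - Nat.card α + 1 := by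
  have hp : (SimpleGraph.hasse α).Preconnected := fun x y =>
    (reachable_hasse_of_le le_sup_left).trans
      (reachable_hasse_of_le (le_sup_right : y ≤ x ⊔ y)).symm
  have := hp.subsingleton_connectedComponent
  have h1 : Nat.card (SimpleGraph.hasse α).ConnectedComponent = 1 :=
    Nat.card_eq_one_iff_unique.2 ⟨this, ⟨SimpleGraph.connectedComponentMk _ (Classical.arbitrary α)⟩⟩
  rw [posetNullity, ncard_edgeSet_hasse, h1]
  rfl

theorem RedFrame.Inv.posetNullity_eq {α : Type*} [Lattice α] [Finite α] {F : RedFrame α}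
    {S : Set α} [Nonempty α] (h : F.Inv S) :
    posetNullity α = (covSet S).ncard - S.ncard + 1 := by
  have := h.card
  rw [_root_.posetNullity_eq]
  omega

end Nullity

/-! ### Transport along isomorphisms. -/

section Iso

variable {P Q : Type*} [PartialOrder P] [PartialOrder Q]

theorem OrderIso.isIrr_iff (e : P ≃o Q) {x : P} : IsIrr (e x) ↔ IsIrr x := by
  constructor
  · rintro ⟨h1, h2⟩
    exact ⟨fun y hy z hz => e.injective
      (h1 ((apply_covBy_apply_iff e).2 hy) ((apply_covBy_apply_iff e).2 hz)),
      fun y hy z hz => e.injective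
      (h2 ((apply_covBy_apply_iff e).2 hy) ((apply_covBy_apply_iff e).2 hz))⟩
  · rintro ⟨h1, h2⟩
    refine ⟨fun y hy z hz => ?_, fun y hy z hz => ?_⟩ <;>
      obtain ⟨y, rfl⟩ := e.surjective y <;> obtain ⟨z, rfl⟩ := e.surjective z
    · exact congrArg e (h1 ((apply_covBy_apply_iff e).1 hy) ((apply_covBy_apply_iff e).1 hz))
    · exact congrArg e (h2 ((apply_covBy_apply_iff e).1 hy) ((apply_covBy_apply_iff e).1 hz))

theorem ncard_covSet_of_orderIso {S : Set Q} (e : P ≃o S) :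
    (covSet S).ncard = (covSet (Set.univ : Set P)).ncard := by
  have h : covSet S = (fun p : P × P => ((e p.1 : Q), (e p.2 : Q))) '' covSet Set.univ := by
    ext ⟨u, v⟩
    simp only [covSet, Set.mem_ofPred_eq, Set.mem_image, Prod.exists, Prod.mk.injEq]
    constructor
    · intro h
      obtain ⟨a, ha⟩ := e.surjective ⟨u, h.1⟩
      obtain ⟨b, hb⟩ := e.surjective ⟨v, h.2.1⟩
      refine ⟨a, b, covIn_univ.2 ((apply_covBy_apply_iff e).1 (covIn_iff.1 ?_)),
        congrArg Subtype.val ha, congrArg Subtype.val hb⟩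
      rw [ha, hb]
      exact h
    · rintro ⟨a, b, h, rfl, rfl⟩
      exact covIn_iff.2 ((apply_covBy_apply_iff e).2 (covIn_univ.1 h))
  rw [h, Set.ncard_image_of_injective]
  rintro ⟨a, b⟩ ⟨c, d⟩ h
  simpa [Subtype.ext_iff.symm] using h

end Iso

/-! ### Shapes, and the layout of a block over its basic block. -/

/-- The combinatorial type of a lattice whose `n + 1` reducible elements form a chain: the basic
block `B`, whose order is determined by the indices of the reducible elements just below and just
above each element, and the set `G` of gaps between consecutive reducible elements in which the
basic block has no element, but in which the lattice may have irreducible elements. -/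
structure Shape (n : ℕ) where
  B : Type
  G : Type
  [poB : PartialOrder B]
  rd : Fin (n + 1) → B
  dn : B ⊕ G → Fin (n + 1)
  up : B ⊕ G → Fin (n + 1)
  le_iff : ∀ b b' : B, b ≤ b' ↔ b = b' ∨ up (.inl b) ≤ dn (.inl b')
  dn_rd : ∀ i, dn (.inl (rd i)) = i
  up_rd : ∀ i, up (.inl (rd i)) = i
  dn_le_up : ∀ v, dn v ≤ up v
  eq_rd : ∀ v, dn v = up v → v = .inl (rd (dn v))
  irr_iff : ∀ b, IsIrr b ↔ dn (.inl b) ≠ up (.inl b)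
  rd_red : ∀ i,
    (∃ b b', b ≠ rd i ∧ b' ≠ rd i ∧ up (.inl b) ≤ i ∧ up (.inl b') ≤ i ∧
      ∀ v, (up (.inl b) ≤ dn v ∨ .inl b = v) → (up (.inl b') ≤ dn v ∨ .inl b' = v) → i ≤ dn v) ∨
    (∃ b b', b ≠ rd i ∧ b' ≠ rd i ∧ i ≤ dn (.inl b) ∧ i ≤ dn (.inl b') ∧
      ∀ v, (up v ≤ dn (.inl b) ∨ v = .inl b) → (up v ≤ dn (.inl b') ∨ v = .inl b') → up v ≤ i)
  ess : ∀ b, dn (.inl b) ≠ up (.inl b) → ∃ b', dn (.inl b) ≤ dn (.inl b') ∧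
    up (.inl b') ≤ up (.inl b) ∧ ¬ b' ≤ b ∧ ¬ b ≤ b'
  gap : ∀ g v, dn (.inr g) ≤ dn v → up v ≤ up (.inr g) →
    v = .inr g ∨ v = .inl (rd (dn (.inr g))) ∨ v = .inl (rd (up (.inr g)))
  exists_gap : ∀ i j, i < j → (∀ b, i ≤ dn (.inl b) → up (.inl b) ≤ j → b = rd i ∨ b = rd j) →
    ∃ g, dn (.inr g) = i ∧ up (.inr g) = j

attribute [instance] Shape.poB

namespace Shape

variable {n : ℕ} (K : Shape n)

/-- The vertices of a shape: the elements of the basic block and the gaps. -/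
abbrev V : Type := K.B ⊕ K.G

variable {K}

theorem le_rd_iff {b : K.B} {i : Fin (n + 1)} : b ≤ K.rd i ↔ K.up (.inl b) ≤ i := by
  rw [K.le_iff, K.dn_rd]
  exact ⟨fun h => h.elim (fun e => by rw [e, K.up_rd]) id, .inr⟩

theorem rd_le_iff {b : K.B} {i : Fin (n + 1)} : K.rd i ≤ b ↔ i ≤ K.dn (.inl b) := by
  rw [K.le_iff, K.up_rd]
  exact ⟨fun h => h.elim (fun e => by rw [← e, K.dn_rd]) id, .inr⟩

theorem rd_injective : Function.Injective K.rd := fun i j h => by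
  rw [← K.dn_rd i, h, K.dn_rd]

theorem gap_ext {g g' : K.G} (h : K.dn (.inr g) = K.dn (.inr g'))
    (h' : K.up (.inr g) = K.up (.inr g')) : g = g' := by
  rcases K.gap g' (.inr g) h.ge h'.le with h1 | h1 | h1
  · exact Sum.inr_injective h1
  · cases h1
  · cases h1

/-- A distribution of the elements of the poset `P` over the vertices of the shape `K` that
exhibits `P` as a poset of the combinatorial type `K`. -/
structure Layout (K : Shape n) {P : Type*} [PartialOrder P] (κ : P → K.V) : Prop where
  le_iff : ∀ x y, x ≤ y ↔ K.up (κ x) ≤ K.dn (κ y) ∨ (κ x = κ y ∧ x ≤ y)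
  total : ∀ x y, κ x = κ y → x ≤ y ∨ y ≤ x
  surj : ∀ b, ∃ x, κ x = .inl b

/-- An element goes to the member of the basic block near it if there is one. Otherwise it is
inessential, and the vertex is the gap with the same ends. -/
theorem exists_layout {α : Type*} [Lattice α] {F : RedFrame α} {S : Set α}
    (hS : F.Transversal S) (φ : K.B ≃o S) : ∃ κ : α → K.V, K.Layout κ := by
  set ψ : K.B → α := fun b => φ b with hψ
  have hψle : ∀ b b', ψ b ≤ ψ b' ↔ b ≤ b' := fun b b' => φ.le_iff_le
  have hψinj : Function.Injective ψ := Subtype.val_injective.comp φ.injective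
  have hred : ∀ b, IsReducibleElt (ψ b) ↔ K.dn (.inl b) = K.up (.inl b) := fun b => by
    have h1 := hS.irr (ψ b) (φ b).2
    rw [irrIn_iff (x := φ b), φ.isIrr_iff, K.irr_iff] at h1
    exact not_iff_not.1 h1.symm
  have hrd : ∀ i, IsReducibleElt (ψ (K.rd i)) := fun i => by rw [hred, K.dn_rd, K.up_rd]
  have hex : ∀ r : α, IsReducibleElt r → ∃ i, ψ (K.rd i) = r := fun r hr => by
    obtain ⟨b, hb⟩ := φ.surjective ⟨r, hS.red_mem r hr⟩
    have hb' : ψ b = r := congrArg Subtype.val hb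
    refine ⟨K.dn (.inl b), ?_⟩
    rw [← hb', ← Sum.inl_injective (K.eq_rd (.inl b) ((hred b).1 (hb' ▸ hr)))]
  have hrle : ∀ i j, ψ (K.rd i) ≤ ψ (K.rd j) ↔ i ≤ j := fun i j => by
    rw [hψle, le_rd_iff, K.up_rd]
  have hup : ∀ b, F.up (ψ b) = ψ (K.rd (K.up (.inl b))) := fun b => by
    refine le_antisymm (F.up_le (hrd _) ((hψle _ _).2 (le_rd_iff.2 le_rfl))) ?_
    obtain ⟨j, hj⟩ := hex _ (F.up_red (ψ b))
    rw [← hj, hrle, ← le_rd_iff, ← hψle, hj]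
    exact F.le_up _
  have hdn : ∀ b, F.dn (ψ b) = ψ (K.rd (K.dn (.inl b))) := fun b => by
    refine le_antisymm ?_ (F.le_dn (hrd _) ((hψle _ _).2 (rd_le_iff.2 le_rfl)))
    obtain ⟨j, hj⟩ := hex _ (F.dn_red (ψ b))
    rw [← hj, hrle, ← rd_le_iff, ← hψle, hj]
    exact F.dn_le _
  have hess : ∀ x, (∀ b, ¬ F.Near (ψ b) x) → ¬ F.Ess x := fun x hx he => by
    obtain ⟨s, hs, hsx⟩ := hS.ex x he
    obtain ⟨b, hb⟩ := φ.surjective ⟨s, hs⟩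
    exact hx b (by rwa [show ψ b = s from congrArg Subtype.val hb])
  have hκ : ∀ x, ∃ v : K.V, (F.dn x = ψ (K.rd (K.dn v)) ∧ F.up x = ψ (K.rd (K.up v))) ∧
      ((∃ b, v = .inl b ∧ F.Near (ψ b) x) ∨ ((∀ b, ¬ F.Near (ψ b) x) ∧ ∃ g, v = .inr g)) := by
    intro x
    by_cases h : ∃ b, F.Near (ψ b) x
    · obtain ⟨b, hb⟩ := h
      exact ⟨.inl b, ⟨by rw [← hdn, hb.2.1], by rw [← hup, hb.2.2]⟩, .inl ⟨b, rfl, hb⟩⟩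
    push Not at h
    have hr : ¬ IsReducibleElt x := fun hr => by
      obtain ⟨i, hi⟩ := hex x hr
      exact h (K.rd i) (hi ▸ RedFrame.Near.refl)
    obtain ⟨i, hi⟩ := hex _ (F.dn_red x)
    obtain ⟨j, hj⟩ := hex _ (F.up_red x)
    have hij : i < j := by
      refine lt_of_le_of_ne ((hrle i j).1 ?_) ?_
      · rw [hi, hj]
        exact RedFrame.dn_le_up
      · rintro rfl
        exact hr (RedFrame.red_of_dn_eq (hi.symm.trans hj))
    -- A member of the basic block between the ends of `x` is comparable to the inessential `x`. Not
    -- being near `x`, it is one of the ends by the dichotomy, so the gap exists.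
    obtain ⟨g, rfl, rfl⟩ := K.exists_gap i j hij fun b h1 h2 => by
      rw [← rd_le_iff, ← hψle, hi] at h1
      rw [← le_rd_iff, ← hψle, hj] at h2
      have hc : ψ b ≤ x ∨ x ≤ ψ b := by
        by_contra! hc
        exact hess x h ⟨ψ b, h1, h2, hc.1, hc.2⟩
      rcases hc with hc | hc
      · rcases F.le_cases hc with h3 | h3
        · refine .inl (hψinj ?_)
          rw [hi]
          exact le_antisymm ((F.le_up _).trans h3) h1
        · exact absurd h3 (h b)
      · rcases F.le_cases hc with h3 | h3
        · refine .inr (hψinj ?_)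
          rw [hj]
          exact le_antisymm h2 (h3.trans (F.dn_le _))
        · exact absurd h3.symm (h b)
    exact ⟨.inr g, ⟨hi.symm, hj.symm⟩, .inr ⟨h, g, rfl⟩⟩
  choose κ hκ1 hκ2 using hκ
  have hnear : ∀ x y, F.Near x y → κ x = κ y := by
    intro x y h
    rcases hκ2 x with ⟨b, hb, hbx⟩ | ⟨hx, g, hg⟩
    · rcases hκ2 y with ⟨b', hb', hby⟩ | ⟨hy, g, hg⟩
      · have := hS.inj _ (φ b).2 _ (φ b').2 ((hbx.trans h).trans hby.symm)
        rw [hb, hb', hψinj this]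
      · exact absurd (hbx.trans h) (hy b)
    · rcases hκ2 y with ⟨b', hb', hby⟩ | ⟨hy, g', hg'⟩
      · exact absurd (hby.trans h.symm) (hx b')
      · have h1 := h.2.1
        have h2 := h.2.2
        rw [(hκ1 x).1, (hκ1 y).1, hg, hg'] at h1
        rw [(hκ1 x).2, (hκ1 y).2, hg, hg'] at h2
        rw [hg, hg', gap_ext (rd_injective (hψinj h1)) (rd_injective (hψinj h2))]
  refine ⟨κ, fun x y => ?_, fun x y h => ?_, fun b => ⟨ψ b, ?_⟩⟩
  · rw [← hrle, ← (hκ1 x).2, ← (hκ1 y).1]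
    constructor
    · intro h
      exact (F.le_cases h).imp_right fun h' => ⟨hnear x y h', h⟩
    · exact fun h => h.elim RedFrame.le_of_up_le_dn (·.2)
  · rcases hκ2 x with ⟨b, hb, hbx⟩ | ⟨hx, g, hg⟩
    · rcases hκ2 y with ⟨b', hb', hby⟩ | ⟨hy, g, hg⟩
      · rw [hb, hb'] at h
        obtain rfl := Sum.inl_injective h
        exact (hbx.symm.trans hby).1
      · rw [hb, hg] at h
        cases h
    · by_contra! hc
      refine hess x hx ⟨y, ?_, ?_, hc.2, hc.1⟩
      · rw [(hκ1 x).1, h, ← (hκ1 y).1]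
        exact F.dn_le y
      · rw [(hκ1 x).2, h, ← (hκ1 y).2]
        exact F.le_up y
  · rcases hκ2 (ψ b) with ⟨b', hb', hby⟩ | ⟨hy, g, hg⟩
    · rw [hb', hψinj (hS.inj _ (φ b').2 _ (φ b).2 hby)]
    · exact absurd RedFrame.Near.refl (hy b)

end Shape

/-! ### Consequences of having a layout: reducible elements, basic block, nullity. -/

namespace Shape

variable {n : ℕ} {K : Shape n}

namespace Layout

section Poset

variable {P : Type*} [PartialOrder P] {κ : P → K.V} (hκ : K.Layout κ)

include hκ

theorem comp {Q : Type*} [PartialOrder Q] (e : Q ≃o P) : K.Layout (κ ∘ e) where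
  le_iff x y := by
    rw [← e.le_iff_le]
    exact hκ.le_iff _ _
  total x y h := by
    rw [← e.le_iff_le, ← e.le_iff_le (x := y)]
    exact hκ.total _ _ h
  surj b := by
    obtain ⟨x, hx⟩ := hκ.surj b
    exact ⟨e.symm x, by simpa using hx⟩

theorem le_of_up_le_dn {x y : P} (h : K.up (κ x) ≤ K.dn (κ y)) : x ≤ y := (hκ.le_iff x y).2 (.inl h)

theorem eq_of_rd {x y : P} {i : Fin (n + 1)} (hx : κ x = .inl (K.rd i)) (hy : κ y = .inl (K.rd i)) :
    x = y := by
  refine le_antisymm (hκ.le_of_up_le_dn ?_) (hκ.le_of_up_le_dn ?_) <;>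
    rw [hx, hy, K.up_rd, K.dn_rd]

/-- The `i`-th reducible element. -/
noncomputable def rd (i : Fin (n + 1)) : P := (hκ.surj (K.rd i)).choose

theorem κ_rd (i : Fin (n + 1)) : κ (hκ.rd i) = .inl (K.rd i) := (hκ.surj (K.rd i)).choose_spec

theorem le_rd_iff {x : P} {i : Fin (n + 1)} : x ≤ hκ.rd i ↔ K.up (κ x) ≤ i := by
  rw [hκ.le_iff, hκ.κ_rd, K.dn_rd]
  exact ⟨fun h => h.elim id fun h => by rw [h.1, K.up_rd], .inl⟩

theorem rd_le_iff {x : P} {i : Fin (n + 1)} : hκ.rd i ≤ x ↔ i ≤ K.dn (κ x) := by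
  rw [hκ.le_iff, hκ.κ_rd, K.up_rd]
  exact ⟨fun h => h.elim id fun h => by rw [← h.1, K.dn_rd], .inl⟩

theorem rd_le_rd_iff {i j : Fin (n + 1)} : hκ.rd i ≤ hκ.rd j ↔ i ≤ j := by
  rw [hκ.le_rd_iff, hκ.κ_rd, K.up_rd]

theorem rd_injective : Function.Injective hκ.rd := fun _ _ h =>
  le_antisymm (hκ.rd_le_rd_iff.1 h.le) (hκ.rd_le_rd_iff.1 h.ge)

theorem eq_rd_of_dn_eq_up {x : P} (h : K.dn (κ x) = K.up (κ x)) : x = hκ.rd (K.dn (κ x)) :=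
  hκ.eq_of_rd (K.eq_rd _ h) (hκ.κ_rd _)

end Poset

variable {α : Type*} [Lattice α] {κ : α → K.V} (hκ : K.Layout κ)

include hκ

theorem isReducibleElt_rd (i : Fin (n + 1)) : IsReducibleElt (hκ.rd i) := by
  have hne : ∀ {x b}, κ x = .inl b → b ≠ K.rd i → x ≠ hκ.rd i := fun hx hb e => by
    rw [e, hκ.κ_rd] at hx
    exact hb (Sum.inl_injective hx.symm)
  rcases K.rd_red i with ⟨b, b', hb, hb', h, h', hv⟩ | ⟨b, b', hb, hb', h, h', hv⟩ <;>
    obtain ⟨x, hx⟩ := hκ.surj b <;> obtain ⟨y, hy⟩ := hκ.surj b'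
  · refine .inl ⟨x, y, hne hx hb, hne hy hb', le_antisymm ?_ ?_⟩
    · exact sup_le (hκ.le_rd_iff.2 (hx ▸ h)) (hκ.le_rd_iff.2 (hy ▸ h'))
    · rw [hκ.rd_le_iff]
      refine hv _ ?_ ?_
      · rw [← hx]
        exact ((hκ.le_iff _ _).1 le_sup_left).imp_right (·.1)
      · rw [← hy]
        exact ((hκ.le_iff _ _).1 le_sup_right).imp_right (·.1)
  · refine .inr ⟨x, y, hne hx hb, hne hy hb', le_antisymm ?_ ?_⟩
    · rw [hκ.le_rd_iff]
      refine hv _ ?_ ?_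
      · rw [← hx]
        exact ((hκ.le_iff _ _).1 inf_le_left).imp_right (·.1)
      · rw [← hy]
        exact ((hκ.le_iff _ _).1 inf_le_right).imp_right (·.1)
    · exact le_inf (hκ.rd_le_iff.2 (hx ▸ h)) (hκ.rd_le_iff.2 (hy ▸ h'))

/-- Elements below `x` are either in its own fibre, which is a chain, or below the reducible element
indexed by `dn`. A nontrivial join equal to `x` therefore needs both terms of the second kind, which
puts `x` itself below that element. -/
theorem isReducibleElt_iff {x : α} : IsReducibleElt x ↔ K.dn (κ x) = K.up (κ x) := by
  refine ⟨fun h => ?_, fun h => hκ.eq_rd_of_dn_eq_up h ▸ hκ.isReducibleElt_rd _⟩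
  rcases h with ⟨y, z, hy, hz, h⟩ | ⟨y, z, hy, hz, h⟩
  · have key : ∀ {y}, y ≤ x → κ y = κ x ∨ y ≤ hκ.rd (K.dn (κ x)) := fun {y} hyx => by
      rw [hκ.le_rd_iff]
      exact ((hκ.le_iff _ _).1 hyx).symm.imp_left (·.1)
    have hd : hκ.rd (K.dn (κ x)) ≤ x := hκ.rd_le_iff.2 le_rfl
    have hyx : y ≤ x := h ▸ le_sup_left
    have hzx : z ≤ x := h ▸ le_sup_right
    rcases key hyx with h1 | h1 <;> rcases key hzx with h2 | h2
    · rcases hκ.total _ _ (h1.trans h2.symm) with h3 | h3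
      · exact absurd (by rwa [sup_eq_right.2 h3] at h) hz
      · exact absurd (by rwa [sup_eq_left.2 h3] at h) hy
    · have h3 : hκ.rd (K.dn (κ x)) ≤ y := hκ.rd_le_iff.2 (by rw [h1])
      exact absurd (by rwa [sup_eq_left.2 (h2.trans h3)] at h) hy
    · have h3 : hκ.rd (K.dn (κ x)) ≤ z := hκ.rd_le_iff.2 (by rw [h2])
      exact absurd (by rwa [sup_eq_right.2 (h1.trans h3)] at h) hz
    · have h3 : x ≤ hκ.rd (K.dn (κ x)) := h.symm.trans_le (sup_le h1 h2)
      exact le_antisymm (K.dn_le_up _) (hκ.le_rd_iff.1 h3)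
  · have key : ∀ {y}, x ≤ y → κ y = κ x ∨ hκ.rd (K.up (κ x)) ≤ y := fun {y} hyx => by
      rw [hκ.rd_le_iff]
      exact ((hκ.le_iff _ _).1 hyx).symm.imp_left (·.1.symm)
    have hyx : x ≤ y := h ▸ inf_le_left
    have hzx : x ≤ z := h ▸ inf_le_right
    rcases key hyx with h1 | h1 <;> rcases key hzx with h2 | h2
    · rcases hκ.total _ _ (h1.trans h2.symm) with h3 | h3
      · exact absurd (by rwa [inf_eq_left.2 h3] at h) hy
      · exact absurd (by rwa [inf_eq_right.2 h3] at h) hz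
    · have h3 : y ≤ hκ.rd (K.up (κ x)) := hκ.le_rd_iff.2 (by rw [h1])
      exact absurd (by rwa [inf_eq_left.2 (h3.trans h2)] at h) hy
    · have h3 : z ≤ hκ.rd (K.up (κ x)) := hκ.le_rd_iff.2 (by rw [h2])
      exact absurd (by rwa [inf_eq_right.2 (h3.trans h1)] at h) hz
    · have h3 : hκ.rd (K.up (κ x)) ≤ x := (le_inf h1 h2).trans_eq h
      exact le_antisymm (K.dn_le_up _) (hκ.rd_le_iff.1 h3)

theorem setOf_isReducibleElt : {x : α | IsReducibleElt x} = Set.range hκ.rd := by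
  ext x
  constructor
  · exact fun h => ⟨_, (hκ.eq_rd_of_dn_eq_up (hκ.isReducibleElt_iff.1 h)).symm⟩
  · rintro ⟨i, rfl⟩
    exact hκ.isReducibleElt_rd i

theorem ncard_isReducibleElt : {x : α | IsReducibleElt x}.ncard = n + 1 := by
  rw [hκ.setOf_isReducibleElt, ← Set.image_univ, Set.ncard_image_of_injective _ hκ.rd_injective,
    Set.ncard_univ, Nat.card_eq_fintype_card, Fintype.card_fin]

theorem isChain_isReducibleElt : IsChain (· ≤ ·) {x : α | IsReducibleElt x} := by
  rw [hκ.setOf_isReducibleElt]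
  rintro _ ⟨i, rfl⟩ _ ⟨j, rfl⟩ -
  exact (le_total i j).imp hκ.rd_le_rd_iff.2 hκ.rd_le_rd_iff.2

theorem isBlock : IsBlock α :=
  ⟨⟨_, fun _ => hκ.rd_le_iff.2 (Fin.zero_le _), hκ.isReducibleElt_rd 0⟩,
    ⟨_, fun _ => hκ.le_rd_iff.2 (Fin.le_last _), hκ.isReducibleElt_rd (Fin.last n)⟩⟩

/-- The greatest reducible element below, and the least one above, a given element. -/
noncomputable def frame : RedFrame α where
  dn x := hκ.rd (K.dn (κ x))
  up x := hκ.rd (K.up (κ x))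
  dn_red _ := hκ.isReducibleElt_rd _
  up_red _ := hκ.isReducibleElt_rd _
  dn_le _ := hκ.rd_le_iff.2 le_rfl
  le_up _ := hκ.le_rd_iff.2 le_rfl
  le_dn {r x} hr h := by
    rw [hκ.eq_rd_of_dn_eq_up (hκ.isReducibleElt_iff.1 hr)] at h ⊢
    rwa [hκ.rd_le_rd_iff, ← hκ.rd_le_iff]
  up_le {x r} hr h := by
    rw [hκ.eq_rd_of_dn_eq_up (hκ.isReducibleElt_iff.1 hr)] at h ⊢
    rwa [hκ.rd_le_rd_iff, ← hκ.le_rd_iff]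

theorem near_iff {x y : α} : hκ.frame.Near x y ↔ κ x = κ y := by
  constructor
  · rintro ⟨h1, h2, h3⟩
    have key : ∀ {x y}, x ≤ y → K.dn (κ x) = K.dn (κ y) → K.up (κ x) = K.up (κ y) → κ x = κ y := by
      intro x y h h2 h3
      rcases (hκ.le_iff x y).1 h with h | h
      · have h4 : K.dn (κ x) = K.up (κ x) := le_antisymm (K.dn_le_up _) (h2 ▸ h)
        rw [K.eq_rd _ h4, K.eq_rd _ (h2.symm.trans (h4.trans h3)), h2]
      · exact h.1
    have h2 := hκ.rd_injective h2
    have h3 := hκ.rd_injective h3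
    exact h1.elim (fun h => key h h2 h3) (fun h => (key h h2.symm h3.symm).symm)
  · intro h
    exact ⟨hκ.total _ _ h, congrArg (fun v => hκ.rd (K.dn v)) h, congrArg (fun v => hκ.rd (K.up v)) h⟩

theorem not_ess {x : α} {g : K.G} (hx : κ x = .inr g) : ¬ hκ.frame.Ess x := by
  rintro ⟨w, h1, h2, h3, h4⟩
  have h1' := hκ.rd_le_iff.1 h1
  have h2' := hκ.le_rd_iff.1 h2
  rw [hx] at h1' h2'
  rcases K.gap g (κ w) h1' h2' with h | h | h
  · exact (hκ.total _ _ (h.trans hx.symm)).elim h3 h4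
  · exact h3 (hκ.le_of_up_le_dn (by rw [h, K.up_rd, hx]))
  · exact h4 (hκ.le_of_up_le_dn (by rw [h, K.dn_rd, hx]))

theorem ess {x : α} {b : K.B} (hx : κ x = .inl b) (hb : K.dn (.inl b) ≠ K.up (.inl b)) :
    hκ.frame.Ess x := by
  obtain ⟨b', h1, h2, h3, h4⟩ := K.ess b hb
  obtain ⟨y, hy⟩ := hκ.surj b'
  refine ⟨y, hκ.rd_le_iff.2 (by rwa [hx, hy]), hκ.le_rd_iff.2 (by rwa [hx, hy]), fun h => h3 ?_,
    fun h => h4 ?_⟩ <;> rw [K.le_iff]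
  · rw [hκ.le_iff, hx, hy] at h
    exact h.symm.imp_left fun h => Sum.inl_injective h.1
  · rw [hκ.le_iff, hx, hy] at h
    exact h.symm.imp_left fun h => Sum.inl_injective h.1

/-- A transversal meets each fibre over the basic block exactly once and no fibre over a gap, as gap
elements are neither reducible nor essential. -/
theorem nonempty_orderIso {S : Set α} (hS : hκ.frame.Transversal S) : Nonempty (K.B ≃o S) := by
  have h1 : ∀ b, ∃ s : S, κ s = .inl b := by
    intro b
    obtain ⟨x, hx⟩ := hκ.surj b
    by_cases hb : K.dn (.inl b) = K.up (.inl b)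
    · exact ⟨⟨x, hS.red_mem x (hκ.isReducibleElt_iff.2 (by rwa [hx]))⟩, hx⟩
    · obtain ⟨s, hs, hsx⟩ := hS.ex x (hκ.ess hx hb)
      exact ⟨⟨s, hs⟩, (hκ.near_iff.1 hsx).trans hx⟩
  choose σ hσ using h1
  have h2 : ∀ b b', σ b ≤ σ b' ↔ b ≤ b' := by
    intro b b'
    rw [K.le_iff, ← Subtype.coe_le_coe, hκ.le_iff, hσ, hσ]
    constructor
    · exact fun h => h.symm.imp_left fun h => Sum.inl_injective h.1
    · rintro (rfl | h)
      · exact .inr ⟨rfl, le_rfl⟩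
      · exact .inl h
  refine ⟨RelIso.ofSurjective (OrderEmbedding.ofMapLEIff σ h2) fun s => ?_⟩
  rcases hs : κ s with b | g
  · refine ⟨b, Subtype.ext (hS.inj _ (σ b).2 _ s.2 (hκ.near_iff.2 ?_))⟩
    rw [hs]
    exact hσ b
  · have hne : ¬ hκ.frame.Ess s := hκ.not_ess hs
    have hr : IsReducibleElt (s : α) := by
      by_contra hr
      exact hne (hS.ess s s.2 hr)
    have h3 := K.eq_rd _ (hκ.isReducibleElt_iff.1 hr)
    rw [hs] at h3
    cases h3

theorem posetNullity_eq [Finite α] :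
    posetNullity α = (covSet (Set.univ : Set K.B)).ncard - Nat.card K.B + 1 := by
  obtain ⟨S, hS⟩ := hκ.frame.exists_isAssocBasicBlockSet
  have hT := hκ.frame.transversal_of_isAssocBasicBlockSet hS
  obtain ⟨e⟩ := hκ.nonempty_orderIso hT
  have : Nonempty α := ⟨hκ.rd 0⟩
  rw [hT.toInv.posetNullity_eq, ncard_covSet_of_orderIso e, Nat.card_congr e.toEquiv,
    Nat.card_coe_set_eq]

theorem isRCBlock [Finite α] {k : ℕ}
    (hk : ((covSet (Set.univ : Set K.B)).ncard : ℤ) - Nat.card K.B + 1 = k) :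
    IsRCBlock α (n + 1) k :=
  ⟨hκ.isBlock, hκ.isChain_isReducibleElt, hκ.ncard_isReducibleElt, by rw [hκ.posetNullity_eq, hk]⟩

theorem exists_isAssocBasicBlockSet [Finite α] :
    ∃ S : Set α, IsAssocBasicBlockSet S ∧ Nonempty (K.B ≃o S) := by
  obtain ⟨S, hS⟩ := hκ.frame.exists_isAssocBasicBlockSet
  exact ⟨S, hS, hκ.nonempty_orderIso (hκ.frame.transversal_of_isAssocBasicBlockSet hS)⟩

end Layout

end Shape

/-! ### The shapes of `B₈` and of its two pieces, checked by computation. -/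

section Decide

theorem isIrr_iff_forall {P : Type*} [PartialOrder P] (c : P → P → Prop)
    (hc : ∀ u v, u ⋖ v ↔ c u v) (x : P) :
    IsIrr x ↔ (∀ u v, c u x → c v x → u = v) ∧ (∀ u v, c x u → c x v → u = v) := by
  simp only [IsIrr, Set.Subsingleton, Set.mem_ofPred_eq, hc]
  exact ⟨fun h => ⟨fun u v hu hv => h.1 hu hv, fun u v hu hv => h.2 hu hv⟩,
    fun h => ⟨fun u hu v hv => h.1 u v hu hv, fun u hu v hv => h.2 u v hu hv⟩⟩

theorem covBy_iff_forall {P : Type*} [PartialOrder P] {u v : P} :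
    u ⋖ v ↔ (u ≤ v ∧ u ≠ v) ∧ ∀ w, ¬ ((u ≤ w ∧ u ≠ w) ∧ (w ≤ v ∧ w ≠ v)) := by
  simp only [CovBy, lt_iff_le_and_ne]
  grind

theorem ncard_covSet_univ {P : Type*} [PartialOrder P] [Fintype P] [DecidableEq P]
    (c : P → P → Prop) [∀ u v, Decidable (c u v)] (hc : ∀ u v, u ⋖ v ↔ c u v) :
    (covSet (Set.univ : Set P)).ncard = (Finset.univ.filter fun p : P × P => c p.1 p.2).card := by
  rw [← Set.ncard_coe_finset]
  congr 1
  ext ⟨u, v⟩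
  simp [covSet, covIn_univ, hc]

end Decide

namespace B8

instance : DecidableRel ((· ≤ ·) : B8 → B8 → Prop) :=
  fun u v => inferInstanceAs (Decidable (v ∈ above u))

/-- The upper covers of an element of `B₈`. -/
def covers : B8 → List B8
  | o => [a, c1]
  | a => [b, c2]
  | b => [c]
  | c => [x, c3]
  | x => [i]
  | i => []
  | c1 => [b]
  | c2 => [c]
  | c3 => [i]

theorem covBy_iff : ∀ u v : B8, u ⋖ v ↔ v ∈ covers u := by
  simp only [covBy_iff_forall]
  decide

/-- The index of the greatest reducible element below an element of `B₈`. -/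
def dn : B8 → Fin 5
  | o => 0 | a => 1 | b => 2 | c => 3 | x => 3 | i => 4 | c1 => 0 | c2 => 1 | c3 => 3

/-- The index of the least reducible element above an element of `B₈`. -/
def up : B8 → Fin 5
  | o => 0 | a => 1 | b => 2 | c => 3 | x => 4 | i => 4 | c1 => 2 | c2 => 3 | c3 => 4

/-- The reducible elements of `B₈`. -/
def rd : Fin 5 → B8 := ![o, a, b, c, i]

/-- The combinatorial type of the blocks with associated basic block `B₈`. -/
def shape : Shape 4 where
  B := B8
  G := Fin 3
  rd := rd
  dn := Sum.elim dn (fun g => g.castSucc.castSucc)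
  up := Sum.elim up (fun g => g.succ.castSucc)
  le_iff := by decide
  dn_rd := by decide
  up_rd := by decide
  dn_le_up := by decide
  eq_rd := by decide
  irr_iff := by
    simp only [isIrr_iff_forall _ covBy_iff]
    decide
  rd_red := by decide
  ess := by decide
  gap := by decide
  exists_gap := by decide

end B8

/-- The part of `B₈` below `c`: a chain `o ⋖ a ⋖ b ⋖ c` and further elements with `o ⋖ c1 ⋖ b` and
`a ⋖ c2 ⋖ c`. -/
inductive Hexagon : Type
  | o | a | b | c | c1 | c2
  deriving DecidableEq

namespace Hexagon

instance : Fintype Hexagon where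
  elems := {o, a, b, c, c1, c2}
  complete := by intro u; cases u <;> decide

/-- The elements above a given element. -/
def above : Hexagon → List Hexagon
  | o => [o, a, b, c, c1, c2]
  | a => [a, b, c, c2]
  | b => [b, c]
  | c => [c]
  | c1 => [c1, b, c]
  | c2 => [c2, c]

instance : PartialOrder Hexagon where
  le u v := v ∈ above u
  le_refl := by decide
  le_trans := by decide
  le_antisymm := by decide

instance : DecidableRel ((· ≤ ·) : Hexagon → Hexagon → Prop) :=
  fun u v => inferInstanceAs (Decidable (v ∈ above u))

/-- The upper covers of a given element. -/
def covers : Hexagon → List Hexagon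
  | o => [a, c1]
  | a => [b, c2]
  | b => [c]
  | c => []
  | c1 => [b]
  | c2 => [c]

theorem covBy_iff : ∀ u v : Hexagon, u ⋖ v ↔ v ∈ covers u := by
  simp only [covBy_iff_forall]
  decide

/-- The index of the greatest reducible element below a given element. -/
def dn : Hexagon → Fin 4
  | o => 0 | a => 1 | b => 2 | c => 3 | c1 => 0 | c2 => 1

/-- The index of the least reducible element above a given element. -/
def up : Hexagon → Fin 4
  | o => 0 | a => 1 | b => 2 | c => 3 | c1 => 2 | c2 => 3

/-- The combinatorial type of the blocks whose associated basic block is `Hexagon`. -/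
def shape : Shape 3 where
  B := Hexagon
  G := Fin 3
  rd := ![o, a, b, c]
  dn := Sum.elim dn Fin.castSucc
  up := Sum.elim up Fin.succ
  le_iff := by decide
  dn_rd := by decide
  up_rd := by decide
  dn_le_up := by decide
  eq_rd := by decide
  irr_iff := by
    simp only [isIrr_iff_forall _ covBy_iff]
    decide
  rd_red := by decide
  ess := by decide
  gap := by decide
  exists_gap := by decide

end Hexagon

/-- The part of `B₈` above `c`: two incomparable elements between a least and a greatest one. -/
inductive Diamond : Type
  | o | i | x | y
  deriving DecidableEq

namespace Diamond

instance : Fintype Diamond where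
  elems := {o, i, x, y}
  complete := by intro u; cases u <;> decide

/-- The elements above a given element. -/
def above : Diamond → List Diamond
  | o => [o, i, x, y]
  | i => [i]
  | x => [x, i]
  | y => [y, i]

instance : PartialOrder Diamond where
  le u v := v ∈ above u
  le_refl := by decide
  le_trans := by decide
  le_antisymm := by decide

instance : DecidableRel ((· ≤ ·) : Diamond → Diamond → Prop) :=
  fun u v => inferInstanceAs (Decidable (v ∈ above u))

/-- The upper covers of a given element. -/
def covers : Diamond → List Diamond
  | o => [x, y]
  | i => []
  | x => [i]
  | y => [i]

theorem covBy_iff : ∀ u v : Diamond, u ⋖ v ↔ v ∈ covers u := by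
  simp only [covBy_iff_forall]
  decide

/-- The index of the greatest reducible element below a given element. -/
def dn : Diamond → Fin 2
  | o => 0 | i => 1 | x => 0 | y => 0

/-- The index of the least reducible element above a given element. -/
def up : Diamond → Fin 2
  | o => 0 | i => 1 | x => 1 | y => 1

/-- The combinatorial type of the blocks whose associated basic block is `Diamond`. -/
def shape : Shape 1 where
  B := Diamond
  G := Fin 0
  rd := ![o, i]
  dn := Sum.elim dn Fin.elim0
  up := Sum.elim up Fin.elim0
  le_iff := by decide
  dn_rd := by decide
  up_rd := by decide
  dn_le_up := by decide
  eq_rd := by decide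
  irr_iff := by
    simp only [isIrr_iff_forall _ covBy_iff]
    decide
  rd_red := by decide
  ess := by decide
  gap := by decide
  exists_gap := by decide

end Diamond

/-- Nine elements and eleven covers give nullity `11 - 9 + 1 = 3`. -/
theorem B8.isRCBlock {α : Type*} [Lattice α] [Finite α] {κ : α → B8.shape.V}
    (hκ : B8.shape.Layout κ) : IsRCBlock α 5 3 := by
  refine hκ.isRCBlock ?_
  rw [show (covSet (Set.univ : Set B8.shape.B)).ncard = 11 from
    (ncard_covSet_univ _ B8.covBy_iff).trans (by decide), show Nat.card B8.shape.B = Fintype.card B8 from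
      Nat.card_eq_fintype_card (α := B8)]
  rfl

theorem Hexagon.isRCBlock {α : Type*} [Lattice α] [Finite α] {κ : α → Hexagon.shape.V}
    (hκ : Hexagon.shape.Layout κ) : IsRCBlock α 4 2 := by
  refine hκ.isRCBlock ?_
  rw [show (covSet (Set.univ : Set Hexagon.shape.B)).ncard = 7 from
    (ncard_covSet_univ _ Hexagon.covBy_iff).trans (by decide),
    show Nat.card Hexagon.shape.B = Fintype.card Hexagon from
      Nat.card_eq_fintype_card (α := Hexagon)]
  rfl

theorem Diamond.isRCBlock {α : Type*} [Lattice α] [Finite α] {κ : α → Diamond.shape.V}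
    (hκ : Diamond.shape.Layout κ) : IsRCBlock α 2 1 := by
  refine hκ.isRCBlock ?_
  rw [show (covSet (Set.univ : Set Diamond.shape.B)).ncard = 4 from
    (ncard_covSet_univ _ Diamond.covBy_iff).trans (by decide),
    show Nat.card Diamond.shape.B = Fintype.card Diamond from
      Nat.card_eq_fintype_card (α := Diamond)]
  rfl

theorem B8.class_iff {α : Type*} [Lattice α] [Finite α] :
    IsRCBlock α 5 3 ∧ IsAssocBasicBlock B8 α ↔ ∃ κ : α → B8.shape.V, B8.shape.Layout κ := by
  constructor
  · rintro ⟨h, S, hS, ⟨e⟩⟩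
    obtain ⟨F⟩ := exists_redFrame h.1 h.2.1
    exact Shape.exists_layout (K := B8.shape) (F.transversal_of_isAssocBasicBlockSet hS) e
  · rintro ⟨κ, hκ⟩
    exact ⟨B8.isRCBlock hκ, hκ.exists_isAssocBasicBlockSet⟩

/-! ### Recognising the two pieces from nullity and height. -/

theorem nonempty_orderIso_fin {P : Type*} [PartialOrder P] [Finite P]
    (h : ∀ x y : P, x ≤ y ∨ y ≤ x) {m : ℕ} (hm : Nat.card P = m) : Nonempty (Fin m ≃o P) := by
  classical
  have := Fintype.ofFinite P
  let _ : LinearOrder P :=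
    { (inferInstance : PartialOrder P) with
      le_total := h
      toDecidableLE := Classical.decRel _ }
  exact ⟨Fintype.orderIsoFinOfCardEq P (by rw [← hm, Nat.card_eq_fintype_card])⟩

theorem exists_strictMono_range_eq {P : Type*} [PartialOrder P] [Finite P] {s : Set P}
    (hs : IsChain (· ≤ ·) s) {m : ℕ} (hm : s.ncard = m) :
    ∃ ρ : Fin m → P, StrictMono ρ ∧ Set.range ρ = s := by
  obtain ⟨e⟩ := nonempty_orderIso_fin (P := s) (fun x y => hs.total x.2 y.2)
    ((Nat.card_coe_set_eq s).trans hm)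
  refine ⟨fun i => e i, fun i j hij => e.lt_iff_lt.2 hij, ?_⟩
  rw [show (fun i => (e i : P)) = Subtype.val ∘ e from rfl, Set.range_comp, e.range_eq,
    Set.image_univ, Subtype.range_coe]

theorem krullDim_eq_of_strictMono {P : Type*} [Preorder P] {m : ℕ} {f : Fin (m + 1) → P}
    (hf : StrictMono f) {g : P → Fin (m + 1)} (hg : StrictMono g) :
    Order.krullDim P = ((m : ℕ∞) : WithBot ℕ∞) := by
  apply le_antisymm
  · refine (Order.krullDim_le_of_strictMono g hg).trans ?_
    refine iSup_le fun l => ?_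
    have := l.length_lt_card
    rw [Fintype.card_fin] at this
    exact_mod_cast Nat.lt_succ_iff.1 this
  · exact Order.LTSeries.length_le_krullDim (LTSeries.mk m f hf)

theorem length_le_of_krullDim_eq {P : Type*} [Preorder P] {m k : ℕ} {f : Fin (m + 1) → P}
    (hf : StrictMono f) (h : Order.krullDim P = ((k : ℕ∞) : WithBot ℕ∞)) : m ≤ k := by
  have := Order.LTSeries.length_le_krullDim (LTSeries.mk m f hf)
  rw [h] at this
  exact_mod_cast this

namespace RedFrame.Transversal

variable {α : Type*} [Lattice α] {F : RedFrame α} {S : Set α} (hS : F.Transversal S)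

include hS

theorem le_iff {x y : α} (hx : x ∈ S) (hy : y ∈ S) : x ≤ y ↔ x = y ∨ F.up x ≤ F.dn y :=
  ⟨fun h => (F.le_cases h).symm.imp_left (hS.inj x hx y hy),
    fun h => h.elim le_of_eq F.le_of_up_le_dn⟩

theorem nonempty_orderIso {n : ℕ} {K : Shape n} {ρ : Fin (n + 1) → α} (hρ : StrictMono ρ)
    {ψ : K.B → α} (hψ : Set.range ψ = S) (hinj : Function.Injective ψ)
    (hdn : ∀ b, F.dn (ψ b) = ρ (K.dn (.inl b))) (hup : ∀ b, F.up (ψ b) = ρ (K.up (.inl b))) :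
    Nonempty (K.B ≃o S) := by
  have hmem : ∀ b, ψ b ∈ S := fun b => hψ ▸ Set.mem_range_self b
  have h : ∀ b b', (⟨ψ b, hmem b⟩ : S) ≤ ⟨ψ b', hmem b'⟩ ↔ b ≤ b' := fun b b' => by
    rw [K.le_iff, Subtype.mk_le_mk, hS.le_iff (hmem b) (hmem b'), hdn, hup, hρ.le_iff_le,
      hinj.eq_iff]
  refine ⟨RelIso.ofSurjective (OrderEmbedding.ofMapLEIff (fun b => (⟨ψ b, hmem b⟩ : S)) h) ?_⟩
  rintro ⟨s, hs⟩
  rw [← hψ] at hs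
  obtain ⟨b, rfl⟩ := hs
  exact ⟨b, rfl⟩

variable [Finite α]

theorem covIn_dn {x : α} (hx : x ∈ S) (hr : ¬ IsReducibleElt x) : CovIn S (F.dn x) x := by
  obtain ⟨y, z, hy, -, hdy, -⟩ := hS.exists_cov hx hr
  rcases (hS.le_iff hy.1 hx).1 hy.2.2.1.le with h | h
  · exact absurd h hy.2.2.1.ne
  · rwa [← le_antisymm ((F.le_up y).trans h) hdy]

theorem covIn_up {x : α} (hx : x ∈ S) (hr : ¬ IsReducibleElt x) : CovIn S x (F.up x) := by
  obtain ⟨y, z, -, hz, -, hzu⟩ := hS.exists_cov hx hr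
  rcases (hS.le_iff hx hz.2.1).1 hz.2.2.1.le with h | h
  · exact absurd h hz.2.2.1.ne
  · rwa [← le_antisymm hzu (h.trans (F.dn_le z))]

/-- Each irreducible element of `S` contributes an edge down to `dn x` and an edge up to `up x`.
These are all distinct and differ from the edges joining two reducible elements. With the nullity
given, this bounds the number of irreducible elements. -/
theorem two_mul_ncard_add_le {C : Set (α × α)} (hC : C ⊆ covSet S)
    (hCr : ∀ p ∈ C, IsReducibleElt p.1 ∧ IsReducibleElt p.2) :
    2 * (S \ {x | IsReducibleElt x}).ncard + C.ncard ≤ (covSet S).ncard := by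
  set N := S \ {x | IsReducibleElt x}
  have h1 : ((fun x => (F.dn x, x)) '' N).ncard = N.ncard :=
    Set.ncard_image_of_injective _ fun x y h => congrArg Prod.snd h
  have h2 : ((fun x => (x, F.up x)) '' N).ncard = N.ncard :=
    Set.ncard_image_of_injective _ fun x y h => congrArg Prod.fst h
  have h3 : Disjoint ((fun x => (F.dn x, x)) '' N) ((fun x => (x, F.up x)) '' N) := by
    rw [Set.disjoint_left]
    rintro _ ⟨x, hx, rfl⟩ ⟨y, hy, h⟩
    exact hy.2 ((show y = F.dn x from congrArg Prod.fst h) ▸ F.dn_red x)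
  have h4 : Disjoint ((fun x => (F.dn x, x)) '' N ∪ (fun x => (x, F.up x)) '' N) C := by
    rw [Set.disjoint_left]
    rintro _ (⟨x, hx, rfl⟩ | ⟨x, hx, rfl⟩) h
    · exact hx.2 (hCr _ h).2
    · exact hx.2 (hCr _ h).1
  have h5 : (fun x => (F.dn x, x)) '' N ∪ (fun x => (x, F.up x)) '' N ∪ C ⊆ covSet S := by
    rintro _ ((⟨x, hx, rfl⟩ | ⟨x, hx, rfl⟩) | h)
    · exact hS.covIn_dn hx.1 hx.2
    · exact hS.covIn_up hx.1 hx.2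
    · exact hC h
  have h6 := Set.ncard_le_ncard h5
  rw [Set.ncard_union_eq h4, Set.ncard_union_eq h3, h1, h2] at h6
  omega

theorem ncard_diff_add : (S \ {x | IsReducibleElt x}).ncard + {x : α | IsReducibleElt x}.ncard =
    S.ncard :=
  Set.ncard_sdiff_add_ncard_of_subset hS.red_mem

end RedFrame.Transversal

namespace Diamond

theorem krullDim_eq : Order.krullDim Diamond = ((2 : ℕ∞) : WithBot ℕ∞) := by
  refine krullDim_eq_of_strictMono (m := 2) (f := ![o, x, i])
    (g := fun u => match u with | o => 0 | i => 2 | x => 1 | y => 1) ?_ ?_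
  · intro u v
    simp only [lt_iff_le_and_ne (α := Diamond)]
    revert u v
    decide
  · intro u v
    simp only [lt_iff_le_and_ne (α := Diamond)]
    revert u v
    decide

/-- Nullity one leaves at most two irreducible elements. The bottom is reducible with no lower
cover, so it has two upper covers, and neither can be the top. -/
theorem nonempty_orderIso {α : Type*} [Lattice α] [Finite α] {F : RedFrame α} {S : Set α}
    (hS : F.Transversal S) (h : IsRCBlock α 2 1) : Nonempty (Diamond ≃o S) := by
  obtain ⟨hb, hc, hr, hn⟩ := h
  obtain ⟨ρ, hρ, hρr⟩ := exists_strictMono_range_eq hc hr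
  have : Nonempty α := ⟨ρ 0⟩
  have hred : ∀ i, IsReducibleElt (ρ i) := fun i => by
    have : ρ i ∈ {x | IsReducibleElt x} := hρr ▸ Set.mem_range_self i
    exact this
  have hex : ∀ r, IsReducibleElt r → ∃ i, ρ i = r := fun r h => by
    have : r ∈ {x | IsReducibleElt x} := h
    rwa [← hρr] at this
  have hm : (S \ {x | IsReducibleElt x}).ncard ≤ 2 := by
    have h1 := hS.two_mul_ncard_add_le (C := ∅) (Set.empty_subset _) (by simp)
    have h2 := hS.ncard_diff_add
    rw [hS.toInv.posetNullity_eq] at hn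
    simp only [Set.ncard_empty] at h1
    omega
  have hN : ∀ x, ¬ IsReducibleElt x → F.dn x = ρ 0 ∧ F.up x = ρ 1 := by
    intro x hx
    obtain ⟨i, hi⟩ := hex _ (F.dn_red x)
    obtain ⟨j, hj⟩ := hex _ (F.up_red x)
    have hij : i < j := hρ.lt_iff_lt.1 (hi ▸ hj ▸ (F.dn_lt hx).trans (F.lt_up hx))
    have : i = 0 ∧ j = 1 := by omega
    rw [← hi, ← hj, this.1, this.2]
    exact ⟨rfl, rfl⟩
  have h0 : ∀ x, ρ 0 ≤ x := fun x => by
    obtain ⟨i, hi⟩ := hex _ (F.dn_red x)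
    exact (hρ.monotone (Fin.zero_le i)).trans (hi ▸ F.dn_le x)
  have h1 : ∀ x, x ≤ ρ 1 := fun x => by
    obtain ⟨i, hi⟩ := hex _ (F.up_red x)
    exact (hi ▸ F.le_up x).trans (hρ.monotone (Fin.le_last i))
  have h2 : ¬ IrrIn S (ρ 0) := by
    rw [hS.irr _ (hS.red_mem _ (hred 0)), not_not]
    exact hred 0
  obtain ⟨x, y, hx, hy, hxy⟩ : ∃ x y, CovIn S (ρ 0) x ∧ CovIn S (ρ 0) y ∧ x ≠ y := by
    by_contra! hh
    exact h2 ⟨fun u u' hu _ => absurd hu.2.2.1 (h0 u).not_gt, hh⟩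
  have hnr : ∀ x y, CovIn S (ρ 0) x → CovIn S (ρ 0) y → x ≠ y → ¬ IsReducibleElt x := by
    intro x y hx hy hxy hr
    obtain ⟨i, rfl⟩ := hex x hr
    have : i = 1 := by
      have := hρ.lt_iff_lt.1 hx.2.2.1
      omega
    subst this
    exact hx.2.2.2 y hy.2.1 ⟨hy.2.2.1, (h1 y).lt_of_ne hxy.symm⟩
  have hxr := hnr x y hx hy hxy
  have hyr := hnr y x hy hx hxy.symm
  have hNeq : {x, y} = S \ {x | IsReducibleElt x} := by
    refine Set.eq_of_subset_of_ncard_le ?_ ?_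
    · rintro _ (rfl | rfl)
      · exact ⟨hx.2.1, hxr⟩
      · exact ⟨hy.2.1, hyr⟩
    · rwa [Set.ncard_pair hxy]
  refine hS.nonempty_orderIso (K := shape) hρ
    (ψ := fun b => match b with | o => ρ 0 | i => ρ 1 | .x => x | .y => y) ?_ ?_ ?_ ?_
  · ext z
    constructor
    · rintro ⟨b, rfl⟩
      cases b
      · exact hS.red_mem _ (hred 0)
      · exact hS.red_mem _ (hred 1)
      · exact hx.2.1
      · exact hy.2.1
    · intro hz
      by_cases hr : IsReducibleElt z
      · obtain ⟨i, rfl⟩ := hex z hr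
        match i with
        | 0 => exact ⟨o, rfl⟩
        | 1 => exact ⟨.i, rfl⟩
      · have : z ∈ ({x, y} : Set α) := hNeq ▸ ⟨hz, hr⟩
        rcases this with rfl | rfl
        · exact ⟨.x, rfl⟩
        · exact ⟨.y, rfl⟩
  · have e0 : ∀ i z, ¬ IsReducibleElt z → ρ i ≠ z := fun i z hz e => hz (e ▸ hred i)
    have e1 : ρ 0 ≠ ρ 1 := hρ.injective.ne (by decide)
    intro b b' hbb
    cases b <;> cases b' <;> first | rfl | skip
    · exact absurd hbb e1
    · exact absurd hbb (e0 _ _ hxr)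
    · exact absurd hbb (e0 _ _ hyr)
    · exact absurd hbb.symm e1
    · exact absurd hbb (e0 _ _ hxr)
    · exact absurd hbb (e0 _ _ hyr)
    · exact absurd hbb.symm (e0 _ _ hxr)
    · exact absurd hbb.symm (e0 _ _ hxr)
    · exact absurd hbb hxy
    · exact absurd hbb.symm (e0 _ _ hyr)
    · exact absurd hbb.symm (e0 _ _ hyr)
    · exact absurd hbb.symm hxy
  · intro b
    cases b
    · exact F.dn_eq (hred 0)
    · exact F.dn_eq (hred 1)
    · exact (hN x hxr).1
    · exact (hN y hyr).1
  · intro b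
    cases b
    · exact F.up_eq (hred 0)
    · exact F.up_eq (hred 1)
    · exact (hN x hxr).2
    · exact (hN y hyr).2

theorem class_iff {α : Type*} [Lattice α] [Finite α] :
    IsRCBlock α 2 1 ∧ HasBasicBlockHeight α 2 ↔ ∃ κ : α → shape.V, shape.Layout κ := by
  constructor
  · rintro ⟨h, S, hS, -⟩
    obtain ⟨F⟩ := exists_redFrame h.1 h.2.1
    have hT := F.transversal_of_isAssocBasicBlockSet hS
    obtain ⟨e⟩ := nonempty_orderIso hT h
    exact Shape.exists_layout (K := shape) hT e
  · rintro ⟨κ, hκ⟩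
    obtain ⟨S, hS, ⟨e⟩⟩ := hκ.exists_isAssocBasicBlockSet
    exact ⟨isRCBlock hκ, S, hS, (Order.krullDim_eq_of_orderIso e).symm.trans krullDim_eq⟩

end Diamond

namespace Hexagon

theorem krullDim_eq : Order.krullDim Hexagon = (((3 : ℕ) : ℕ∞) : WithBot ℕ∞) := by
  refine krullDim_eq_of_strictMono (m := 3) (f := ![o, a, b, c])
    (g := fun u => match u with | o => 0 | a => 1 | b => 2 | c => 3 | c1 => 1 | c2 => 2) ?_ ?_
  · intro u v
    simp only [lt_iff_le_and_ne (α := Hexagon)]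
    revert u v
    decide
  · intro u v
    simp only [lt_iff_le_and_ne (α := Hexagon)]
    revert u v
    decide

theorem eq_of_dn_eq_of_up_eq : ∀ u v : Hexagon, dn u = dn v → up u = up v → u = v := by decide

/-- Height three forces consecutive reducible elements to cover each other in `S`. These three edges
and nullity two leave at most two irreducible elements: `N + 5 ≥ 2 * N + 3`. -/
theorem nonempty_orderIso {α : Type*} [Lattice α] [Finite α] {F : RedFrame α} {S : Set α}
    (hS : F.Transversal S) (h : IsRCBlock α 4 2)
    (hdim : Order.krullDim S = (((3 : ℕ) : ℕ∞) : WithBot ℕ∞)) : Nonempty (Hexagon ≃o S) := by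
  obtain ⟨hb, hc, hr, hn⟩ := h
  obtain ⟨ρ, hρ, hρr⟩ := exists_strictMono_range_eq hc hr
  have : Nonempty α := ⟨ρ 0⟩
  have hred : ∀ i, IsReducibleElt (ρ i) := fun i => by
    have : ρ i ∈ {x | IsReducibleElt x} := hρr ▸ Set.mem_range_self i
    exact this
  have hmem : ∀ i, ρ i ∈ S := fun i => hS.red_mem _ (hred i)
  have hex : ∀ r, IsReducibleElt r → ∃ i, ρ i = r := fun r h => by
    have : r ∈ {x | IsReducibleElt x} := h
    rwa [← hρr] at this
  have h0 : ∀ x, ρ 0 ≤ x := fun x => by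
    obtain ⟨i, hi⟩ := hex _ (F.dn_red x)
    exact (hρ.monotone (Fin.zero_le i)).trans (hi ▸ F.dn_le x)
  have h3 : ∀ x, x ≤ ρ 3 := fun x => by
    obtain ⟨i, hi⟩ := hex _ (F.up_red x)
    exact (hi ▸ F.le_up x).trans (hρ.monotone (Fin.le_last i))
  have hchain : ∀ p ∈ S, ∀ q ∈ S, ∀ r ∈ S, ∀ s ∈ S, ∀ t ∈ S, p < q → q < r → r < s → ¬ s < t := by
    intro p hp q hq r hr s hs t ht h1 h2 h3 h4
    have hf : StrictMono (![⟨p, hp⟩, ⟨q, hq⟩, ⟨r, hr⟩, ⟨s, hs⟩, ⟨t, ht⟩] : Fin 5 → S) := by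
      rw [Fin.strictMono_iff_lt_succ]
      intro i
      match i with
      | 0 => exact h1
      | 1 => exact h2
      | 2 => exact h3
      | 3 => exact h4
    have := length_le_of_krullDim_eq (m := 4) (k := 3) hf hdim
    omega
  have r01 : ρ 0 < ρ 1 := hρ (by decide)
  have r12 : ρ 1 < ρ 2 := hρ (by decide)
  have r23 : ρ 2 < ρ 3 := hρ (by decide)
  have c01 : CovIn S (ρ 0) (ρ 1) := ⟨hmem 0, hmem 1, r01, fun w hw ⟨h1, h2⟩ =>
    hchain _ (hmem 0) _ hw _ (hmem 1) _ (hmem 2) _ (hmem 3) h1 h2 r12 r23⟩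
  have c12 : CovIn S (ρ 1) (ρ 2) := ⟨hmem 1, hmem 2, r12, fun w hw ⟨h1, h2⟩ =>
    hchain _ (hmem 0) _ (hmem 1) _ hw _ (hmem 2) _ (hmem 3) r01 h1 h2 r23⟩
  have c23 : CovIn S (ρ 2) (ρ 3) := ⟨hmem 2, hmem 3, r23, fun w hw ⟨h1, h2⟩ =>
    hchain _ (hmem 0) _ (hmem 1) _ (hmem 2) _ hw _ (hmem 3) r01 r12 h1 h2⟩
  have hm : (S \ {x | IsReducibleElt x}).ncard ≤ 2 := by
    have hC : ({(ρ 0, ρ 1), (ρ 1, ρ 2), (ρ 2, ρ 3)} : Set (α × α)).ncard = 3 := by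
      rw [Set.ncard_eq_three]
      refine ⟨_, _, _, ?_, ?_, ?_, rfl⟩ <;> intro e
      · exact r01.ne (congrArg Prod.fst e)
      · exact (r01.trans r12).ne (congrArg Prod.fst e)
      · exact r12.ne (congrArg Prod.fst e)
    have h1 := hS.two_mul_ncard_add_le (C := {(ρ 0, ρ 1), (ρ 1, ρ 2), (ρ 2, ρ 3)})
      (by rintro _ (rfl | rfl | rfl); exacts [c01, c12, c23])
      (by rintro _ (rfl | rfl | rfl) <;> exact ⟨hred _, hred _⟩)
    have h2 := hS.ncard_diff_add
    rw [hS.toInv.posetNullity_eq] at hn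
    omega
  -- In `S` the only lower cover of `ρ 1` is `ρ 0`, so reducibility supplies an upper cover besides
  -- `ρ 2`. It cannot lie below `ρ 2`, as that covers `ρ 1`, so its chain ends at `ρ 3`. The dual
  -- argument at `ρ 2` gives `x`.
  obtain ⟨y, hy, hyr, hyd, hyu⟩ : ∃ y ∈ S, ¬ IsReducibleElt y ∧ F.dn y = ρ 1 ∧ F.up y = ρ 3 := by
    have hirr : ¬ IrrIn S (ρ 1) := by
      rw [hS.irr _ (hmem 1), not_not]
      exact hred 1
    obtain ⟨y, hy, hy2⟩ : ∃ y, CovIn S (ρ 1) y ∧ y ≠ ρ 2 := by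
      by_contra! hh
      have hlow : ∀ u, CovIn S u (ρ 1) → u = ρ 0 := fun u hu => by
        by_contra hne
        exact c01.2.2.2 u hu.1 ⟨(h0 u).lt_of_ne (Ne.symm hne), hu.2.2.1⟩
      exact hirr ⟨fun u u' hu hu' => (hlow u hu).trans (hlow u' hu').symm,
        fun u u' hu hu' => (hh u hu).trans (hh u' hu').symm⟩
    have hy2' : ¬ ρ 2 ≤ y := fun h => hy.2.2.2 (ρ 2) (hmem 2) ⟨r12, h.lt_of_ne hy2.symm⟩
    have hyr : ¬ IsReducibleElt y := fun hr => by
      obtain ⟨i, rfl⟩ := hex y hr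
      have h1 := hρ.lt_iff_lt.1 hy.2.2.1
      rw [hρ.le_iff_le] at hy2'
      omega
    refine ⟨y, hy.2.1, hyr, ?_, ?_⟩
    · obtain ⟨i, hi⟩ := hex _ (F.dn_red y)
      have h1 := hρ.le_iff_le.1 ((F.le_dn (hred 1) hy.2.2.1.le).trans_eq hi.symm)
      have h2 : ¬ 2 ≤ i := fun h => hy2' ((hρ.monotone h).trans (hi ▸ F.dn_le y))
      rw [← hi, show i = 1 by omega]
    · obtain ⟨i, hi⟩ := hex _ (F.up_red y)
      have h1 := hρ.lt_iff_lt.1 ((hy.2.2.1.trans (F.lt_up hyr)).trans_eq hi.symm)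
      have h2 : i ≠ 2 := fun h => c12.2.2.2 y hy.2.1 ⟨hy.2.2.1, by
        rw [← h, hi]
        exact F.lt_up hyr⟩
      rw [← hi, show i = 3 by omega]
  obtain ⟨x, hx, hxr, hxd, hxu⟩ : ∃ y ∈ S, ¬ IsReducibleElt y ∧ F.dn y = ρ 0 ∧ F.up y = ρ 2 := by
    have hirr : ¬ IrrIn S (ρ 2) := by
      rw [hS.irr _ (hmem 2), not_not]
      exact hred 2
    obtain ⟨y, hy, hy2⟩ : ∃ y, CovIn S y (ρ 2) ∧ y ≠ ρ 1 := by
      by_contra! hh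
      have hlow : ∀ u, CovIn S (ρ 2) u → u = ρ 3 := fun u hu => by
        by_contra hne
        exact c23.2.2.2 u hu.2.1 ⟨hu.2.2.1, (h3 u).lt_of_ne hne⟩
      exact hirr ⟨fun u u' hu hu' => (hh u hu).trans (hh u' hu').symm,
        fun u u' hu hu' => (hlow u hu).trans (hlow u' hu').symm⟩
    have hy2' : ¬ y ≤ ρ 1 := fun h => hy.2.2.2 (ρ 1) (hmem 1) ⟨h.lt_of_ne hy2, r12⟩
    have hyr : ¬ IsReducibleElt y := fun hr => by
      obtain ⟨i, rfl⟩ := hex y hr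
      have h1 := hρ.lt_iff_lt.1 hy.2.2.1
      rw [hρ.le_iff_le] at hy2'
      omega
    refine ⟨y, hy.1, hyr, ?_, ?_⟩
    · obtain ⟨i, hi⟩ := hex _ (F.dn_red y)
      have h1 := hρ.lt_iff_lt.1 (hi.trans_lt ((F.dn_lt hyr).trans hy.2.2.1))
      have h2 : i ≠ 1 := fun h => c12.2.2.2 y hy.1 ⟨by
        rw [← h, hi]
        exact F.dn_lt hyr, hy.2.2.1⟩
      rw [← hi, show i = 0 by omega]
    · obtain ⟨i, hi⟩ := hex _ (F.up_red y)
      have h1 := hρ.le_iff_le.1 (hi.trans_le (F.up_le (hred 2) hy.2.2.1.le))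
      have h2 : ¬ i ≤ 1 := fun h => hy2' ((F.le_up y).trans (hi ▸ hρ.monotone h))
      rw [← hi, show i = 2 by omega]
  have hxy : x ≠ y := fun e => r01.ne (by rw [← hxd, ← hyd, e])
  have hNeq : {x, y} = S \ {x | IsReducibleElt x} := by
    refine Set.eq_of_subset_of_ncard_le ?_ ?_
    · rintro _ (rfl | rfl)
      · exact ⟨hx, hxr⟩
      · exact ⟨hy, hyr⟩
    · rwa [Set.ncard_pair hxy]
  set ψ : Hexagon → α := fun u =>
    match u with | o => ρ 0 | a => ρ 1 | b => ρ 2 | c => ρ 3 | c1 => x | c2 => y with hψ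
  have hdn : ∀ u, F.dn (ψ u) = ρ (dn u) := by
    intro u
    cases u
    exacts [F.dn_eq (hred 0), F.dn_eq (hred 1), F.dn_eq (hred 2), F.dn_eq (hred 3), hxd, hyd]
  have hup : ∀ u, F.up (ψ u) = ρ (up u) := by
    intro u
    cases u
    exacts [F.up_eq (hred 0), F.up_eq (hred 1), F.up_eq (hred 2), F.up_eq (hred 3), hxu, hyu]
  refine hS.nonempty_orderIso (K := shape) hρ (ψ := ψ) ?_ ?_ hdn hup
  · ext z
    constructor
    · rintro ⟨u, rfl⟩
      cases u
      exacts [hmem 0, hmem 1, hmem 2, hmem 3, hx, hy]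
    · intro hz
      by_cases hr : IsReducibleElt z
      · obtain ⟨i, rfl⟩ := hex z hr
        match i with
        | 0 => exact ⟨o, rfl⟩
        | 1 => exact ⟨a, rfl⟩
        | 2 => exact ⟨b, rfl⟩
        | 3 => exact ⟨c, rfl⟩
      · have : z ∈ ({x, y} : Set α) := hNeq ▸ ⟨hz, hr⟩
        rcases this with rfl | rfl
        · exact ⟨c1, rfl⟩
        · exact ⟨c2, rfl⟩
  · intro u v huv
    exact eq_of_dn_eq_of_up_eq u v
      (hρ.injective ((hdn u).symm.trans ((congrArg F.dn huv).trans (hdn v))))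
      (hρ.injective ((hup u).symm.trans ((congrArg F.up huv).trans (hup v))))

theorem class_iff {α : Type*} [Lattice α] [Finite α] :
    IsRCBlock α 4 2 ∧ HasBasicBlockHeight α 3 ↔ ∃ κ : α → shape.V, shape.Layout κ := by
  constructor
  · rintro ⟨h, S, hS, hd⟩
    obtain ⟨F⟩ := exists_redFrame h.1 h.2.1
    have hT := F.transversal_of_isAssocBasicBlockSet hS
    obtain ⟨e⟩ := nonempty_orderIso hT h hd
    exact Shape.exists_layout (K := shape) hT e
  · rintro ⟨κ, hκ⟩
    obtain ⟨S, hS, ⟨e⟩⟩ := hκ.exists_isAssocBasicBlockSet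
    exact ⟨isRCBlock hκ, S, hS, (Order.krullDim_eq_of_orderIso e).symm.trans krullDim_eq⟩

end Hexagon

/-! ### Cutting at `c` and gluing: the vertical sum. -/

namespace LatticeOn

instance {n : ℕ} (L : LatticeOn n) : Finite L.Carrier := inferInstanceAs (Finite (Fin n))

theorem card_carrier {n : ℕ} (L : LatticeOn n) : Nat.card L.Carrier = n := Nat.card_fin n

theorem exists_orderIso {α : Type*} [Lattice α] [Finite α] {m : ℕ} (hm : Nat.card α = m) :
    ∃ L : LatticeOn m, Nonempty (L.Carrier ≃o α) := by
  obtain ⟨e⟩ : Nonempty (Fin m ≃ α) := ⟨(Finite.equivFinOfCardEq hm).symm⟩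
  let lat : Lattice (Fin m) :=
    { le x y := e x ≤ e y
      lt x y := e x < e y
      lt_iff_le_not_ge x y := lt_iff_le_not_ge (a := e x) (b := e y)
      le_refl x := le_refl (e x)
      le_trans _ _ _ h h' := le_trans (α := α) h h'
      le_antisymm _ _ h h' := e.injective (le_antisymm h h')
      sup x y := e.symm (e x ⊔ e y)
      inf x y := e.symm (e x ⊓ e y)
      le_sup_left _ _ := by simp
      le_sup_right _ _ := by simp
      sup_le _ _ _ h h' := by simpa using ⟨h, h'⟩
      inf_le_left _ _ := by simp
      inf_le_right _ _ := by simp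
      le_inf _ _ _ h h' := by simpa using ⟨h, h'⟩ }
  exact ⟨⟨lat⟩, ⟨⟨e, Iff.rfl⟩⟩⟩

end LatticeOn

namespace Shape

/-- Used for the two sides of the cut at the reducible element of index 3. -/
theorem Layout.restrict {n n' : ℕ} {K : Shape n} {K' : Shape n'} {P : Type*} [PartialOrder P]
    {κ : P → K.V} (hκ : K.Layout κ) {ι : K'.V → K.V} (hι : Function.Injective ι)
    (hle : ∀ v w, K'.up v ≤ K'.dn w ↔ K.up (ι v) ≤ K.dn (ι w)) {s : Set P}
    (hs : ∀ x, x ∈ s ↔ ∃ v, ι v = κ x) (hB : ∀ b, ∃ b', ι (.inl b) = .inl b') :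
    ∃ κ' : s → K'.V, K'.Layout κ' := by
  choose κ' hκ' using fun x : s => (hs x).1 x.2
  have heq : ∀ x y, κ' x = κ' y ↔ κ x = κ y := fun x y => by rw [← hκ', ← hκ', hι.eq_iff]
  refine ⟨κ', fun x y => ?_, fun x y h => hκ.total _ _ ((heq x y).1 h), fun b => ?_⟩
  · rw [hle, hκ', hκ', heq, ← Subtype.coe_le_coe, ← hκ.le_iff]
  · obtain ⟨b', hb'⟩ := hB b
    obtain ⟨x, hx⟩ := hκ.surj b'
    exact ⟨⟨x, (hs x).2 ⟨.inl b, hb'.trans hx.symm⟩⟩, hι ((hκ' _).trans (hx.trans hb'.symm))⟩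

theorem Layout.card_le {n : ℕ} {K : Shape n} {P : Type*} [PartialOrder P] [Finite P]
    {κ : P → K.V} (hκ : K.Layout κ) : Nat.card K.B ≤ Nat.card P := by
  choose f hf using hκ.surj
  exact Nat.card_le_card_of_injective f fun b b' h => Sum.inl_injective (by rw [← hf, h, hf])

end Shape

namespace B8

/-- The inclusion of the part of `B₈` below `c`, on the level of shapes. -/
def ofHexagon : Hexagon ⊕ Fin 3 → B8 ⊕ Fin 3 :=
  Sum.map (fun u => match u with | .o => o | .a => a | .b => b | .c => c | .c1 => c1 | .c2 => c2) id

/-- The inclusion of the part of `B₈` above `c`, on the level of shapes. -/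
def ofDiamond : Diamond ⊕ Fin 0 → B8 ⊕ Fin 3 :=
  Sum.map (fun u => match u with | .o => c | .i => i | .x => x | .y => c3) Fin.elim0

/-- The index of the greatest reducible element below a vertex of the shape of `B₈`. -/
abbrev sdn : B8 ⊕ Fin 3 → Fin 5 := shape.dn

/-- The index of the least reducible element above a vertex of the shape of `B₈`. -/
abbrev sup : B8 ⊕ Fin 3 → Fin 5 := shape.up

theorem ofHexagon_injective : Function.Injective ofHexagon := by decide

theorem ofDiamond_injective : Function.Injective ofDiamond := by decide

theorem ofHexagon_le_iff : ∀ v w : Hexagon ⊕ Fin 3,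
    Hexagon.shape.up v ≤ Hexagon.shape.dn w ↔ sup (ofHexagon v) ≤ sdn (ofHexagon w) := by decide

theorem ofDiamond_le_iff : ∀ v w : Diamond ⊕ Fin 0,
    Diamond.shape.up v ≤ Diamond.shape.dn w ↔ sup (ofDiamond v) ≤ sdn (ofDiamond w) := by decide

theorem sup_le_iff : ∀ v : B8 ⊕ Fin 3, sup v ≤ 3 ↔ ∃ w, ofHexagon w = v := by decide

theorem le_sdn_iff : ∀ v : B8 ⊕ Fin 3, 3 ≤ sdn v ↔ ∃ w, ofDiamond w = v := by decide

theorem sup_le_or_le_sdn : ∀ v : B8 ⊕ Fin 3, sup v ≤ 3 ∨ 3 ≤ sdn v := by decide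

theorem lt_sup_ofDiamond : ∀ w : Diamond ⊕ Fin 0, w ≠ .inl .o → 3 < sup (ofDiamond w) := by decide

theorem ofHexagon_inl : ∀ u : Hexagon, ∃ u' : B8, ofHexagon (.inl u) = .inl u' := by decide

theorem ofDiamond_inl : ∀ u : Diamond, ∃ u' : B8, ofDiamond (.inl u) = .inl u' := by decide

theorem inl_cases : ∀ u : B8, (∃ w : Hexagon, ofHexagon (.inl w) = .inl u) ∨
    ∃ w : Diamond, w ≠ .o ∧ ofDiamond (.inl w) = .inl u := by decide

theorem exists_layout_verticalSum {α β : Type*} [Lattice α] [Lattice β] {κ' : α → Hexagon.shape.V}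
    {κ'' : β → Diamond.shape.V} (h' : Hexagon.shape.Layout κ') (h'' : Diamond.shape.Layout κ'') :
    ∃ κ : VerticalSum α β → shape.V, shape.Layout κ := by
  let κ : VerticalSum α β → shape.V := fun z =>
    Sum.elim (fun a => ofHexagon (κ' a)) (fun y : {y : β // ¬ IsBot y} => ofDiamond (κ'' y)) (ofLex z)
  have hbot : ∀ y : β, IsBot y ↔ κ'' y = .inl .o := fun y => by
    constructor
    · intro hy
      rw [le_antisymm (hy (h''.rd 0)) (h''.rd_le_iff.2 (Fin.zero_le _))]
      exact h''.κ_rd 0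
    · intro hy z
      rw [h''.eq_of_rd (i := 0) hy (h''.κ_rd 0), h''.rd_le_iff]
      exact Fin.zero_le _
  have hα : ∀ a, sup (ofHexagon (κ' a)) ≤ 3 := fun a => (sup_le_iff _).2 ⟨_, rfl⟩
  have hβ : ∀ y, 3 ≤ sdn (ofDiamond (κ'' y)) := fun a => (le_sdn_iff _).2 ⟨_, rfl⟩
  -- The bottom of `β` is dropped from the vertical sum, so `c` is represented only by the top of
  -- `α` and the two kinds of vertices never meet.
  have hβ' : ∀ y : {y : β // ¬ IsBot y}, 3 < sup (ofDiamond (κ'' y)) := fun y =>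
    lt_sup_ofDiamond _ fun e => y.2 ((hbot y).2 e)
  have hne : ∀ a (y : {y : β // ¬ IsBot y}), ofHexagon (κ' a) ≠ ofDiamond (κ'' y) := fun a y e =>
    (hβ' y).not_ge (e ▸ hα a)
  refine ⟨κ, ?_, ?_, ?_⟩
  · rintro (a | y) (a' | y')
    · refine Sum.Lex.inl_le_inl_iff.trans ?_
      rw [h'.le_iff]
      exact or_congr (ofHexagon_le_iff _ _)
        (and_congr ofHexagon_injective.eq_iff.symm Sum.Lex.inl_le_inl_iff.symm)
    · exact iff_of_true (Sum.Lex.inl_le_inr _ _) (.inl ((hα a).trans (hβ y')))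
    · refine iff_of_false Sum.Lex.not_inr_le_inl ?_
      rintro (h | h)
      · exact absurd ((hβ' y).trans_le (h.trans ((shape.dn_le_up _).trans (hα a')))) (lt_irrefl _)
      · exact hne a' y h.1.symm
    · refine Sum.Lex.inr_le_inr_iff.trans ?_
      rw [← Subtype.coe_le_coe, h''.le_iff]
      exact or_congr (ofDiamond_le_iff _ _)
        (and_congr ofDiamond_injective.eq_iff.symm
          (Subtype.coe_le_coe.trans Sum.Lex.inr_le_inr_iff.symm))
  · rintro (a | y) (a' | y') h
    · exact (h'.total _ _ (ofHexagon_injective h)).imp Sum.Lex.inl_le_inl_iff.2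
        Sum.Lex.inl_le_inl_iff.2
    · exact absurd h (hne a y')
    · exact absurd h.symm (hne a' y)
    · exact (h''.total _ _ (ofDiamond_injective h)).imp Sum.Lex.inr_le_inr_iff.2
        Sum.Lex.inr_le_inr_iff.2
  · intro u
    rcases inl_cases u with ⟨w, hw⟩ | ⟨w, hwo, hw⟩
    · obtain ⟨a, ha⟩ := h'.surj w
      exact ⟨toLex (.inl a), (congrArg ofHexagon ha).trans hw⟩
    · obtain ⟨y, hy⟩ := h''.surj w
      refine ⟨toLex (.inr ⟨y, fun h => ?_⟩), (congrArg ofDiamond hy).trans hw⟩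
      exact hwo (Sum.inl_injective (hy.symm.trans ((hbot y).1 h)))

end B8

theorem nonempty_orderIso_verticalSum {α β γ : Type*} [Lattice α] [Lattice β] [Lattice γ] {m : α}
    (hm : ∀ x, x ≤ m ∨ m ≤ x) (e : β ≃o Set.Iic m) (e' : γ ≃o Set.Ici m) :
    Nonempty (α ≃o VerticalSum β γ) := by
  let f : VerticalSum β γ → α := fun z =>
    Sum.elim (fun a => (e a : α)) (fun y : {y : γ // ¬ IsBot y} => (e' y : α)) (ofLex z)
  have hle : ∀ b, (e b : α) ≤ m := fun b => (e b).2
  have hlt : ∀ y : {y : γ // ¬ IsBot y}, m < e' y := fun y =>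
    lt_of_le_of_ne (e' y).2 fun h => y.2 fun z => e'.le_iff_le.1 (Subtype.coe_le_coe.1
      (h.ge.trans (e' z).2))
  have hf : ∀ z w, f z ≤ f w ↔ z ≤ w := by
    rintro (a | y) (a' | y')
    · exact e.le_iff_le.trans Sum.Lex.inl_le_inl_iff.symm
    · exact iff_of_true ((hle a).trans (hlt y').le) (Sum.Lex.inl_le_inr _ _)
    · exact iff_of_false (fun h => ((hlt y).trans_le (h.trans (hle a'))).false)
        Sum.Lex.not_inr_le_inl
    · exact (e'.le_iff_le (x := y.1) (y := y'.1)).trans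
        (Subtype.coe_le_coe.trans Sum.Lex.inr_le_inr_iff.symm)
  refine ⟨(RelIso.ofSurjective (OrderEmbedding.ofMapLEIff f hf) fun x => ?_).symm⟩
  by_cases hx : x ≤ m
  · exact ⟨toLex (.inl (e.symm ⟨x, hx⟩)), congrArg Subtype.val (e.apply_symm_apply ⟨x, hx⟩)⟩
  · have hx' : m ≤ x := (hm x).resolve_left hx
    refine ⟨toLex (.inr ⟨e'.symm ⟨x, hx'⟩, fun h => hx ?_⟩),
      congrArg Subtype.val (e'.apply_symm_apply ⟨x, hx'⟩)⟩
    have := e'.le_iff_le.2 (h (e'.symm ⟨m, Set.self_mem_Ici⟩))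
    rwa [e'.apply_symm_apply, e'.apply_symm_apply] at this

theorem B8.class_iff_exists_verticalSum {j : ℕ} (L : LatticeOn j) :
    InClassWithBasicBlock B8 L ↔
      ∃ p q : ℕ, 6 ≤ p ∧ 4 ≤ q ∧ p + q = j + 1 ∧
        ∃ (L' : LatticeOn p) (L'' : LatticeOn q),
          InClassWithHeight 4 2 3 L' ∧ InClassWithHeight 2 1 2 L'' ∧
            Nonempty (L.Carrier ≃o VerticalSum L'.Carrier L''.Carrier) := by
  rw [InClassWithBasicBlock, B8.class_iff]
  simp only [InClassWithHeight, Hexagon.class_iff, Diamond.class_iff]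
  constructor
  · rintro ⟨κ, hκ⟩
    set m := hκ.rd 3
    have hm : ∀ x, x ≤ m ∨ m ≤ x := fun x => by
      rw [hκ.le_rd_iff, hκ.rd_le_iff]
      exact sup_le_or_le_sdn _
    obtain ⟨κ', h'⟩ := hκ.restrict (K' := Hexagon.shape) (s := Set.Iic m) ofHexagon_injective
      ofHexagon_le_iff (fun x => hκ.le_rd_iff.trans (sup_le_iff _)) ofHexagon_inl
    obtain ⟨κ'', h''⟩ := hκ.restrict (K' := Diamond.shape) (s := Set.Ici m) ofDiamond_injective
      ofDiamond_le_iff (fun x => hκ.rd_le_iff.trans (le_sdn_iff _)) ofDiamond_inl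
    obtain ⟨L', ⟨e'⟩⟩ := LatticeOn.exists_orderIso (α := Set.Iic m) rfl
    obtain ⟨L'', ⟨e''⟩⟩ := LatticeOn.exists_orderIso (α := Set.Ici m) rfl
    refine ⟨_, _, ?_, ?_, ?_, L', L'', ⟨_, h'.comp e'⟩, ⟨_, h''.comp e''⟩, ?_⟩
    · exact (show Nat.card Hexagon = 6 from Nat.card_eq_fintype_card (α := Hexagon)) ▸ h'.card_le
    · exact (show Nat.card Diamond = 4 from Nat.card_eq_fintype_card (α := Diamond)) ▸ h''.card_le
    · rw [Nat.card_coe_set_eq, Nat.card_coe_set_eq, ← Set.ncard_union_add_ncard_inter,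
        show Set.Iic m ∪ Set.Ici m = Set.univ from Set.eq_univ_of_forall hm,
        show Set.Iic m ∩ Set.Ici m = {m} by
          rw [Set.inter_comm, Set.Ici_inter_Iic, Set.Icc_self],
        Set.ncard_univ, Set.ncard_singleton, L.card_carrier]
    · exact nonempty_orderIso_verticalSum hm e' e''
  · rintro ⟨p, q, -, -, -, L', L'', ⟨κ', h'⟩, ⟨κ'', h''⟩, ⟨e⟩⟩
    obtain ⟨κ, hκ⟩ := exists_layout_verticalSum h' h''
    exact ⟨_, hκ.comp e⟩

/-! ### Duality between `B₈` and `B₉`. -/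

section Duality

theorem isReducibleElt_toDual {α : Type*} [Lattice α] {x : α} :
    IsReducibleElt (OrderDual.toDual x) ↔ IsReducibleElt x := Or.comm

theorem posetNullity_orderDual (α : Type*) [PartialOrder α] : posetNullity αᵒᵈ = posetNullity α := by
  rw [posetNullity, posetNullity, ← Nat.card_coe_set_eq, ← Nat.card_coe_set_eq,
    Nat.card_congr (SimpleGraph.hasseDualIso (α := α)).mapEdgeSet,
    Nat.card_congr (SimpleGraph.hasseDualIso (α := α)).connectedComponentEquiv,
    Nat.card_congr (OrderDual.ofDual (α := α))]

theorem IsRCBlock.orderDual {α : Type*} [Lattice α] {r k : ℕ} (h : IsRCBlock α r k) :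
    IsRCBlock αᵒᵈ r k := by
  obtain ⟨⟨⟨b, hb, hbr⟩, t, ht, htr⟩, hc, hr, hn⟩ := h
  have hset : {x : αᵒᵈ | IsReducibleElt x} = OrderDual.ofDual ⁻¹' {x : α | IsReducibleElt x} :=
    Set.ext fun x => isReducibleElt_toDual (x := OrderDual.ofDual x)
  refine ⟨⟨⟨OrderDual.toDual t, ht, isReducibleElt_toDual.2 htr⟩,
    OrderDual.toDual b, hb, isReducibleElt_toDual.2 hbr⟩, ?_, ?_, ?_⟩
  · rw [hset]
    intro x hx y hy hne
    exact (hc hx hy hne).symm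
  · rw [hset, ← Set.ncard_preimage_of_injective_subset_range OrderDual.ofDual.injective (by simp)]
      at *
    exact hr
  · rw [posetNullity_orderDual, hn]

variable {P Q : Type*} [PartialOrder P] [PartialOrder Q] {a : P ≃ Q}

section

variable (ha : ∀ x y, a x ≤ a y ↔ y ≤ x)

include ha

/-- An arbitrary order-reversing bijection is allowed so that the same lemmas serve the whole poset
and, through `Equiv.image`, its subsets. -/
theorem covBy_of_antitone {x y : P} : a x ⋖ a y ↔ y ⋖ x := by
  simp only [covBy_iff_forall, ha, a.surjective.forall, a.injective.ne_iff]
  grind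

theorem IsIrr.of_antitone {x : P} (h : IsIrr x) : IsIrr (a x) := by
  refine ⟨fun y hy z hz => ?_, fun y hy z hz => ?_⟩ <;>
    obtain ⟨y, rfl⟩ := a.surjective y <;> obtain ⟨z, rfl⟩ := a.surjective z
  · exact congrArg a (h.2 ((covBy_of_antitone ha).1 hy) ((covBy_of_antitone ha).1 hz))
  · exact congrArg a (h.1 ((covBy_of_antitone ha).1 hy) ((covBy_of_antitone ha).1 hz))

theorem antitone_symm (x y : Q) : a.symm x ≤ a.symm y ↔ y ≤ x := by
  rw [← ha, a.apply_symm_apply, a.apply_symm_apply]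

theorem isIrr_iff_of_antitone {x : P} : IsIrr (a x) ↔ IsIrr x :=
  ⟨fun h => by simpa using h.of_antitone (antitone_symm ha), fun h => h.of_antitone ha⟩

theorem IsPendant.of_antitone {x : P} (h : IsPendant x) : IsPendant (a x) := by
  have : (SimpleGraph.hasse Q).neighborSet (a x) = a '' (SimpleGraph.hasse P).neighborSet x := by
    ext y
    obtain ⟨y, rfl⟩ := a.surjective y
    rw [a.injective.mem_set_image]
    simp only [SimpleGraph.mem_neighborSet, SimpleGraph.hasse_adj, covBy_of_antitone ha]
    exact or_comm
  rw [IsPendant, this, Set.ncard_image_of_injective _ a.injective]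
  exact h

theorem IsRetractible.of_antitone [Finite P] [Finite Q] {x : P} (h : IsRetractible x) :
    IsRetractible (a x) := by
  obtain ⟨h1, h2⟩ := h
  refine ⟨h1.of_antitone ha, h2.imp (fun h => ?_) ?_⟩
  · rintro ⟨y, z, hy, hz, hyx, hxz⟩
    obtain ⟨y, rfl⟩ := a.surjective y
    obtain ⟨z, rfl⟩ := a.surjective z
    rw [isIrr_iff_of_antitone ha] at hy hz
    rw [covBy_of_antitone ha] at hyx hxz
    exact h ⟨z, y, hz, hy, hxz, hyx⟩
  · rintro ⟨y, z, hy, hz, hyx, hxz, h⟩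
    have hzx := (covBy_of_antitone ha).2 hxz
    have hxy := (covBy_of_antitone ha).2 hyx
    refine ⟨a z, a y, by rwa [isIrr_iff_of_antitone ha], by rwa [isIrr_iff_of_antitone ha], hzx, hxy,
      ?_⟩
    rw [unique_path_iff hyx hxz] at h
    rw [unique_path_iff hzx hxy]
    intro w h3 h4
    obtain ⟨w, rfl⟩ := a.surjective w
    rw [ha] at h3 h4
    simp only [a.injective.eq_iff]
    rcases h w h4 h3 with h | h | h
    · exact .inr (.inr h)
    · exact .inr (.inl h)
    · exact .inl h

theorem antitone_image (S : Set P) (x y : S) : a.image S x ≤ a.image S y ↔ y ≤ x := ha x y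

theorem RetractStep.of_antitone [Finite P] [Finite Q] {S T : Set P} (h : RetractStep S T) :
    RetractStep (a '' S) (a '' T) := by
  obtain ⟨hn, x, hx, rfl⟩ := h
  refine ⟨hn.image a.injective, a.image S x, hx.of_antitone (antitone_image ha S), ?_⟩
  rw [Set.image_sdiff a.injective, Set.image_singleton]
  rfl

theorem PendantStep.of_antitone {S T : Set P} (h : PendantStep S T) :
    PendantStep (a '' S) (a '' T) := by
  obtain ⟨x, hx, rfl⟩ := h
  refine ⟨a.image S x, hx.of_antitone (antitone_image ha S), ?_⟩
  rw [Set.image_sdiff a.injective, Set.image_singleton]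
  rfl

theorem IsAssocBasicBlockSet.of_antitone [Finite P] [Finite Q] {S : Set P}
    (h : IsAssocBasicBlockSet S) : IsAssocBasicBlockSet (a '' S) := by
  obtain ⟨R, ⟨hR, hR'⟩, hS, hS'⟩ := h
  refine ⟨a '' R, ⟨?_, fun T hT => ?_⟩, ?_, fun T hT => ?_⟩
  · have : Relation.ReflTransGen RetractStep (a '' Set.univ) (a '' R) :=
      Relation.ReflTransGen.lift (a '' ·) (fun _ _ h => RetractStep.of_antitone ha h) _ _ hR
    rwa [Set.image_univ, a.range_eq_univ] at this
  · have := hT.of_antitone (antitone_symm ha)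
    rw [a.symm_image_image] at this
    exact hR' _ this
  · exact Relation.ReflTransGen.lift (a '' ·) (fun _ _ h => PendantStep.of_antitone ha h) _ _ hS
  · have := hT.of_antitone (antitone_symm ha)
    rw [a.symm_image_image] at this
    exact hS' _ this

end

theorem IsAssocBasicBlock.orderDual {B : Type*} [PartialOrder B] [Finite P]
    (h : IsAssocBasicBlock B P) : IsAssocBasicBlock Bᵒᵈ Pᵒᵈ := by
  obtain ⟨S, hS, ⟨e⟩⟩ := h
  have ha : ∀ x y : P, OrderDual.toDual x ≤ OrderDual.toDual y ↔ y ≤ x := fun _ _ => Iff.rfl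
  refine ⟨_, hS.of_antitone ha, ⟨?_⟩⟩
  exact
    { toEquiv := OrderDual.ofDual.trans (e.toEquiv.trans (OrderDual.toDual.image S))
      map_rel_iff' := e.le_iff_le }

theorem inClass_B9_iff {j : ℕ} (L : LatticeOn j) :
    InClassWithBasicBlock B9 L ↔ InClassWithBasicBlock B8 L.dual :=
  ⟨fun h => ⟨h.1.orderDual, h.2.orderDual⟩, fun h => ⟨h.1.orderDual, h.2.orderDual⟩⟩

theorem numIsoClasses_B9_eq (j : ℕ) :
    numIsoClasses j (fun L => InClassWithBasicBlock B9 L) =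
      numIsoClasses j (fun L => InClassWithBasicBlock B8 L) := by
  let d : Quotient (LatticeOn.isoSetoid j) → Quotient (LatticeOn.isoSetoid j) :=
    Quotient.map LatticeOn.dual fun _ _ ⟨e⟩ => ⟨e.dual⟩
  have hd : ∀ q, d (d q) = q := fun q => by
    induction q using Quotient.inductionOn
    rfl
  rw [numIsoClasses, numIsoClasses, ← Set.ncard_image_of_injective _
    (Function.LeftInverse.injective hd)]
  congr 1
  ext q
  constructor
  · rintro ⟨_, ⟨L, hL, rfl⟩, rfl⟩
    exact ⟨L.dual, (inClass_B9_iff L).1 hL, rfl⟩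
  · rintro ⟨L, hL, rfl⟩
    exact ⟨_, ⟨L.dual, (inClass_B9_iff L.dual).2 hL, rfl⟩, rfl⟩

end Duality

/-! ### Model lattices with prescribed fibre sizes. -/

namespace Shape

variable {n : ℕ} {K : Shape n}

section Weight

/-- The numbers of elements at the vertices of a shape. -/
structure Weight (K : Shape n) where
  wt : K.V → ℕ
  wt_rd : ∀ i, wt (.inl (K.rd i)) = 1
  wt_pos : ∀ b, 0 < wt (.inl b)

/-- The poset of shape `K` with given numbers of elements at the vertices. -/
def Model (w : Weight K) : Type := Σ v : K.V, Fin (w.wt v)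

instance (w : Weight K) : PartialOrder (Model w) where
  le x y := K.up x.1 ≤ K.dn y.1 ∨ (x.1 = y.1 ∧ (x.2 : ℕ) ≤ y.2)
  le_refl x := .inr ⟨rfl, le_rfl⟩
  le_trans x y z h h' := by
    rcases h with h | h <;> rcases h' with h' | h'
    · exact .inl (h.trans ((K.dn_le_up _).trans h'))
    · exact .inl (h'.1 ▸ h)
    · exact .inl (h.1 ▸ h')
    · exact .inr ⟨h.1.trans h'.1, h.2.trans h'.2⟩
  le_antisymm x y h h' := by
    -- If an inequality through `up` and `dn` is involved, the two ends of the vertex coincide; the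
    -- vertex is then reducible and its fibre has one element.
    have key : x.1 = y.1 ∧ (K.dn x.1 = K.up x.1 ∨ (x.2 : ℕ) = y.2) := by
      rcases h with h | h <;> rcases h' with h' | h'
      · have h1 := K.dn_le_up x.1
        have h2 := K.dn_le_up y.1
        have h3 : K.dn x.1 = K.up x.1 := by order
        have h4 : K.dn y.1 = K.up y.1 := by order
        have h5 : K.dn x.1 = K.dn y.1 := by order
        exact ⟨by rw [K.eq_rd _ h3, K.eq_rd _ h4, h5], .inl h3⟩
      · exact ⟨h'.1.symm, .inl (le_antisymm (K.dn_le_up _) (h'.1 ▸ h))⟩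
      · exact ⟨h.1, .inl (le_antisymm (K.dn_le_up _) (h.1 ▸ h'))⟩
      · exact ⟨h.1, .inr (le_antisymm h.2 h'.2)⟩
    obtain ⟨v, s⟩ := x
    obtain ⟨v', t⟩ := y
    obtain ⟨rfl, h1⟩ := key
    congr 1
    rcases h1 with h1 | h1
    · have h2 : w.wt v = 1 := by
        rw [K.eq_rd v h1]
        exact w.wt_rd _
      ext
      omega
    · exact Fin.ext h1

theorem layout_model (w : Weight K) : K.Layout (fun x : Model w => x.1) where
  le_iff _ _ := ⟨fun h => h.imp_right fun h' => ⟨h'.1, h⟩, fun h => h.elim .inl (·.2)⟩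
  total x y h := (le_total (x.2 : ℕ) y.2).imp (fun h' => .inr ⟨h, h'⟩) (fun h' => .inr ⟨h.symm, h'⟩)
  surj b := ⟨⟨.inl b, ⟨0, w.wt_pos b⟩⟩, rfl⟩

instance [Finite K.V] (w : Weight K) : Finite (Model w) :=
  inferInstanceAs (Finite (Σ v : K.V, Fin (w.wt v)))

theorem card_model [Fintype K.V] (w : Weight K) : Nat.card (Model w) = ∑ v, w.wt v := by
  rw [show Nat.card (Model w) = Nat.card (Σ v : K.V, Fin (w.wt v)) from rfl, Nat.card_sigma]
  simp

theorem card_fiber_model (w : Weight K) (v : K.V) :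
    Nat.card {x : Model w // x.1 = v} = w.wt v := by
  rw [← Nat.card_fin (w.wt v)]
  exact Nat.card_congr (Equiv.sigmaSubtype v)

end Weight

namespace Layout

/-- A poset of a given combinatorial type is a lattice. -/
noncomputable abbrev lattice {P : Type*} [PartialOrder P] {κ : P → K.V} (hκ : K.Layout κ) :
    Lattice P := by
  classical
  -- A common upper bound of two incomparable elements shares a fibre with neither, as otherwise
  -- they would be comparable. So it lies above the reducible ends of both, and the larger end is
  -- the join.
  have key : ∀ {x y z}, x ≤ z → y ≤ z → ¬ x ≤ y → ¬ y ≤ x → K.up (κ x) ≤ K.dn (κ z) := by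
    intro x y z h1 h2 h3 h4
    rcases (hκ.le_iff x z).1 h1 with h | h
    · exact h
    rcases (hκ.le_iff y z).1 h2 with h' | h'
    · exact absurd (hκ.le_of_up_le_dn (h.1 ▸ h')) h4
    · exact ((hκ.total x y (h.1.trans h'.1.symm)).elim h3 h4).elim
  have key' : ∀ {x y z}, z ≤ x → z ≤ y → ¬ x ≤ y → ¬ y ≤ x → K.up (κ z) ≤ K.dn (κ x) := by
    intro x y z h1 h2 h3 h4
    rcases (hκ.le_iff z x).1 h1 with h | h
    · exact h
    rcases (hκ.le_iff z y).1 h2 with h' | h'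
    · exact absurd (hκ.le_of_up_le_dn (h.1 ▸ h')) h3
    · exact ((hκ.total x y (h.1.symm.trans h'.1)).elim h3 h4).elim
  exact
    { (inferInstance : PartialOrder P) with
      sup x y := if x ≤ y then y else if y ≤ x then x else hκ.rd (max (K.up (κ x)) (K.up (κ y)))
      inf x y := if x ≤ y then x else if y ≤ x then y else hκ.rd (min (K.dn (κ x)) (K.dn (κ y)))
      le_sup_left x y := by
        split_ifs with h h'
        · exact h
        · exact le_rfl
        · exact hκ.le_rd_iff.2 (le_max_left _ _)
      le_sup_right x y := by
        split_ifs with h h'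
        · exact le_rfl
        · exact h'
        · exact hκ.le_rd_iff.2 (le_max_right _ _)
      sup_le x y z h1 h2 := by
        split_ifs with h h'
        · exact h2
        · exact h1
        · exact hκ.rd_le_iff.2 (max_le (key h1 h2 h h') (key h2 h1 h' h))
      inf_le_left x y := by
        split_ifs with h h'
        · exact le_rfl
        · exact h'
        · exact hκ.rd_le_iff.2 (min_le_left _ _)
      inf_le_right x y := by
        split_ifs with h h'
        · exact h
        · exact le_rfl
        · exact hκ.rd_le_iff.2 (min_le_right _ _)
      le_inf z x y h1 h2 := by
        split_ifs with h h'
        · exact h1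
        · exact h2
        · exact hκ.le_rd_iff.2 (le_min (key' h1 h2 h h') (key' h2 h1 h' h)) }

/-- Fibres are chains, so equal sizes give isomorphic fibres; between different fibres the order
depends on the vertices alone. -/
theorem nonempty_orderIso_of_card_fiber {P Q : Type*} [PartialOrder P] [PartialOrder Q] [Finite P]
    [Finite Q] {κ : P → K.V} {κ' : Q → K.V} (hκ : K.Layout κ) (hκ' : K.Layout κ')
    (h : ∀ v, Nat.card {x // κ x = v} = Nat.card {y // κ' y = v}) : Nonempty (P ≃o Q) := by
  have he : ∀ v, Nonempty ({x // κ x = v} ≃o {y // κ' y = v}) := fun v => by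
    obtain ⟨e⟩ := nonempty_orderIso_fin (P := {x // κ x = v})
      (fun x y => hκ.total _ _ (x.2.trans y.2.symm)) (h v)
    obtain ⟨e'⟩ := nonempty_orderIso_fin (P := {y // κ' y = v})
      (fun x y => hκ'.total _ _ (x.2.trans y.2.symm)) rfl
    exact ⟨e.symm.trans e'⟩
  let e := fun v => (he v).some
  let f : P → Q := fun x => e (κ x) ⟨x, rfl⟩
  have hfκ : ∀ x, κ' (f x) = κ x := fun x => (e (κ x) ⟨x, rfl⟩).2
  have hfe : ∀ v x (hx : κ x = v), f x = e v ⟨x, hx⟩ := by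
    rintro v x rfl
    rfl
  have hf : ∀ x y, f x ≤ f y ↔ x ≤ y := fun x y => by
    rw [hκ.le_iff, hκ'.le_iff, hfκ, hfκ]
    refine or_congr_right (and_congr_right fun hxy => ?_)
    rw [hfe _ x hxy, hfe _ y rfl, Subtype.coe_le_coe, (e (κ y)).le_iff_le, Subtype.mk_le_mk]
  refine ⟨RelIso.ofSurjective (OrderEmbedding.ofMapLEIff f hf) fun y => ?_⟩
  obtain ⟨⟨x, hx⟩, hxy⟩ := (e (κ' y)).surjective ⟨y, rfl⟩
  exact ⟨x, (hfe _ x hx).trans (congrArg Subtype.val hxy)⟩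

end Layout

end Shape

/-! ### How far a layout is determined by the lattice. -/

namespace RedFrame

theorem dn_unique {α : Type*} [Lattice α] (F F' : RedFrame α) (x : α) : F.dn x = F'.dn x :=
  le_antisymm (F'.le_dn (F.dn_red x) (F.dn_le x)) (F.le_dn (F'.dn_red x) (F'.dn_le x))

theorem up_unique {α : Type*} [Lattice α] (F F' : RedFrame α) (x : α) : F.up x = F'.up x :=
  le_antisymm (F.up_le (F'.up_red x) (F'.le_up x)) (F'.up_le (F.up_red x) (F.le_up x))

end RedFrame

namespace Shape.Layout

variable {n : ℕ} {K : Shape n} {α : Type*} [Lattice α] {κ κ' : α → K.V} (hκ : K.Layout κ)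
  (hκ' : K.Layout κ')

include hκ hκ'

/-- Both are increasing enumerations of the set of reducible elements. -/
theorem rd_unique : hκ.rd = hκ'.rd := by
  have key : ∀ {κ : α → K.V} (hκ : K.Layout κ), StrictMono hκ.rd := fun hκ i j hij =>
    lt_of_le_of_ne (hκ.rd_le_rd_iff.2 hij.le) (hκ.rd_injective.ne hij.ne)
  exact (key hκ).range_inj (key hκ') |>.1
    (hκ.setOf_isReducibleElt.symm.trans hκ'.setOf_isReducibleElt)

theorem dn_unique (x : α) : K.dn (κ x) = K.dn (κ' x) := by
  have h : hκ.rd (K.dn (κ x)) = hκ'.rd (K.dn (κ' x)) := hκ.frame.dn_unique hκ'.frame x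
  rw [hκ.rd_unique hκ'] at h
  exact hκ'.rd_injective h

theorem up_unique (x : α) : K.up (κ x) = K.up (κ' x) := by
  have h : hκ.rd (K.up (κ x)) = hκ'.rd (K.up (κ' x)) := hκ.frame.up_unique hκ'.frame x
  rw [hκ.rd_unique hκ'] at h
  exact hκ'.rd_injective h

theorem eq_iff (x y : α) : κ x = κ y ↔ κ' x = κ' y := by
  rw [← hκ.near_iff, ← hκ'.near_iff]
  simp only [RedFrame.Near, hκ.frame.dn_unique hκ'.frame, hκ.frame.up_unique hκ'.frame]

omit hκ' in
theorem card_fiber_rd (i : Fin (n + 1)) : Nat.card {x // κ x = .inl (K.rd i)} = 1 := by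
  rw [Nat.card_eq_one_iff_unique]
  exact ⟨⟨fun x y => Subtype.ext (hκ.eq_of_rd x.2 y.2)⟩, ⟨⟨_, hκ.κ_rd i⟩⟩⟩

omit hκ' in
theorem comp_perm (σ : Equiv.Perm K.V) (hdn : ∀ v, K.dn (σ v) = K.dn v)
    (hup : ∀ v, K.up (σ v) = K.up v) (hB : ∀ b, ∃ b', σ.symm (.inl b) = .inl b') :
    K.Layout (σ ∘ κ) where
  le_iff x y := by
    simp only [Function.comp, hdn, hup, σ.injective.eq_iff]
    exact hκ.le_iff x y
  total x y h := hκ.total x y (σ.injective h)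
  surj b := by
    obtain ⟨b', hb'⟩ := hB b
    obtain ⟨x, hx⟩ := hκ.surj b'
    exact ⟨x, by rw [Function.comp, hx, ← hb', σ.apply_symm_apply]⟩

end Shape.Layout

namespace B8

theorem vertex_ext : ∀ v w : B8 ⊕ Fin 3, v ≠ .inl x → v ≠ .inl c3 → sdn v = sdn w →
    sup v = sup w → v = w := by decide

theorem sdn_eq_and_sup_eq : ∀ v : B8 ⊕ Fin 3,
    sdn v = 3 ∧ sup v = 4 ↔ v = .inl x ∨ v = .inl c3 := by decide

variable {α : Type*} [Lattice α] {κ κ' : α → B8 ⊕ Fin 3}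

theorem card_fiber_eq (hκ : shape.Layout κ) (hκ' : shape.Layout κ') {v : B8 ⊕ Fin 3}
    (hx : v ≠ .inl x) (h3 : v ≠ .inl c3) :
    Nat.card {y // κ y = v} = Nat.card {y // κ' y = v} := by
  have hiff : ∀ (κ : α → B8 ⊕ Fin 3) y, κ y = v ↔ sdn (κ y) = sdn v ∧ sup (κ y) = sup v :=
    fun κ y => ⟨fun h => by rw [h]; exact ⟨rfl, rfl⟩,
      fun h => (vertex_ext _ _ hx h3 h.1.symm h.2.symm).symm⟩
  refine Nat.card_congr (Equiv.subtypeEquivRight fun y => ?_)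
  rw [hiff, hiff, show sdn (κ y) = sdn (κ' y) from hκ.dn_unique hκ' y,
    show sup (κ y) = sup (κ' y) from hκ.up_unique hκ' y]

theorem card_fiber_add {α : Type*} [Finite α] (κ : α → B8 ⊕ Fin 3) :
    Nat.card {y // κ y = .inl x} + Nat.card {y // κ y = .inl c3} =
      Nat.card {y // sdn (κ y) = 3 ∧ sup (κ y) = 4} := by
  have h : {y | sdn (κ y) = 3 ∧ sup (κ y) = 4} = {y | κ y = .inl x} ∪ {y | κ y = .inl c3} :=
    Set.ext fun y => sdn_eq_and_sup_eq (κ y)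
  have hd : Disjoint {y | κ y = .inl x} {y | κ y = .inl c3} :=
    Set.disjoint_left.2 fun y h1 h2 => by
      have := h1.symm.trans h2
      simp at this
  have := Set.ncard_union_eq hd
  rw [← h] at this
  exact this.symm

/-- The vertices `x` and `c3` have the same ends, so layouts may exchange their fibres, and only the
unordered pair of sizes is an invariant. This is the source of the partitions in the formula. -/
theorem card_fiber_x [Finite α] (hκ : shape.Layout κ) (hκ' : shape.Layout κ') :
    (Nat.card {y // κ y = .inl x} = Nat.card {y // κ' y = .inl x} ∧
      Nat.card {y // κ y = .inl c3} = Nat.card {y // κ' y = .inl c3}) ∨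
    (Nat.card {y // κ y = .inl x} = Nat.card {y // κ' y = .inl c3} ∧
      Nat.card {y // κ y = .inl c3} = Nat.card {y // κ' y = .inl x}) := by
  obtain ⟨z, hz⟩ := hκ.surj x
  have h1 : Nat.card {y // κ y = .inl x} = Nat.card {y // κ' y = κ' z} :=
    Nat.card_congr (Equiv.subtypeEquivRight fun y => 
      (iff_of_eq (congrArg (κ y = ·) hz.symm)).trans (hκ.eq_iff hκ' y z))
  have h2 : Nat.card {y // sdn (κ y) = 3 ∧ sup (κ y) = 4} =
      Nat.card {y // sdn (κ' y) = 3 ∧ sup (κ' y) = 4} :=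
    Nat.card_congr (Equiv.subtypeEquivRight fun y => by
      rw [show sdn (κ y) = sdn (κ' y) from hκ.dn_unique hκ' y,
        show sup (κ y) = sup (κ' y) from hκ.up_unique hκ' y])
  rw [← card_fiber_add, ← card_fiber_add] at h2
  have h3 : κ' z = .inl x ∨ κ' z = .inl c3 := by
    rw [← sdn_eq_and_sup_eq, ← show sdn (κ z) = sdn (κ' z) from hκ.dn_unique hκ' z,
      ← show sup (κ z) = sup (κ' z) from hκ.up_unique hκ' z, sdn_eq_and_sup_eq]
    exact .inl hz
  rcases h3 with h3 | h3 <;> rw [h3] at h1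
  · exact .inl ⟨h1, by omega⟩
  · exact .inr ⟨h1, by omega⟩

/-- The numbers of elements at the vertices of the shape of `B₈`, for a lattice with `f k` elements
in excess of the least possible number at the vertices outside of the uppermost interval, and with
`s + 1` and `t + 1` elements at the two irreducible vertices of the uppermost interval. -/
def wt (f : Fin 5 → ℕ) (s t : ℕ) : B8 ⊕ Fin 3 → ℕ :=
  Sum.elim (fun u => match u with
    | o => 1 | a => 1 | b => 1 | c => 1 | i => 1
    | c1 => f 3 + 1 | c2 => f 4 + 1 | x => s + 1 | c3 => t + 1) ![f 0, f 1, f 2]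

/-- The numbers given by `wt`, bundled as a weight. -/
def weight (f : Fin 5 → ℕ) (s t : ℕ) : shape.Weight where
  wt := wt f s t
  wt_rd k := match k with
    | 0 => rfl | 1 => rfl | 2 => rfl | 3 => rfl | 4 => rfl
  wt_pos u := match u with
    | o => Nat.succ_pos _ | a => Nat.succ_pos _ | b => Nat.succ_pos _ | c => Nat.succ_pos _
    | x => Nat.succ_pos _ | i => Nat.succ_pos _ | c1 => Nat.succ_pos _ | c2 => Nat.succ_pos _
    | c3 => Nat.succ_pos _

instance : Fintype shape.V := inferInstanceAs (Fintype (B8 ⊕ Fin 3))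

theorem card_model (f : Fin 5 → ℕ) (s t : ℕ) :
    Nat.card (Shape.Model (weight f s t)) = ∑ k, f k + s + t + 9 := by
  rw [Shape.card_model (K := shape) (weight f s t)]
  have h : ∑ v : B8 ⊕ Fin 3, wt f s t v = ∑ k, f k + s + t + 9 := by
    rw [Fintype.sum_sum_type, show (Finset.univ : Finset B8) = {o, a, b, c, x, i, c1, c2, c3} from rfl]
    simp [wt, Fin.sum_univ_succ]
    ring
  exact h

theorem card_fiber_comp {P Q V : Type*} (e : P ≃ Q) (κ : Q → V) (v : V) :
    Nat.card {y // (κ ∘ e) y = v} = Nat.card {y // κ y = v} :=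
  Nat.card_congr (e.subtypeEquiv fun _ => Iff.rfl)

theorem eq_of_orderIso_model [Finite α] {f f' : Fin 5 → ℕ} {s t s' t' : ℕ} (hst : s ≤ t)
    (hst' : s' ≤ t') (e : α ≃o Shape.Model (weight f s t))
    (e' : α ≃o Shape.Model (weight f' s' t')) : f = f' ∧ s = s' ∧ t = t' := by
  have hκ := (Shape.layout_model (weight f s t)).comp e
  have hκ' := (Shape.layout_model (weight f' s' t')).comp e'
  have h1 : ∀ v, Nat.card {y // ((fun x => x.1) ∘ e) y = v} = wt f s t v := fun v =>
    (card_fiber_comp e.toEquiv _ v).trans (Shape.card_fiber_model _ v)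
  have h2 : ∀ v, Nat.card {y // ((fun x => x.1) ∘ e') y = v} = wt f' s' t' v := fun v =>
    (card_fiber_comp e'.toEquiv _ v).trans (Shape.card_fiber_model _ v)
  have h3 : ∀ v : B8 ⊕ Fin 3, v ≠ .inl x → v ≠ .inl c3 → wt f s t v = wt f' s' t' v :=
    fun v hx hc => (h1 v).symm.trans ((card_fiber_eq hκ hκ' hx hc).trans (h2 v))
  have h4 := card_fiber_x hκ hκ'
  erw [h1, h1, h2, h2] at h4
  refine ⟨funext fun k => ?_, ?_⟩
  · match k with
    | 0 => exact h3 (.inr 0) (by decide) (by decide)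
    | 1 => exact h3 (.inr 1) (by decide) (by decide)
    | 2 => exact h3 (.inr 2) (by decide) (by decide)
    | 3 => exact Nat.succ_injective (h3 (.inl c1) (by decide) (by decide))
    | 4 => exact Nat.succ_injective (h3 (.inl c2) (by decide) (by decide))
  · simp only [wt, Sum.elim_inl] at h4
    omega

/-- The permutation of the vertices of the shape of `B₈` that exchanges `x` and `c3`. -/
def swapVertices : Equiv.Perm (B8 ⊕ Fin 3) := Equiv.swap (.inl x) (.inl c3)

theorem exists_orderIso_model [Finite α] (hκ : shape.Layout κ) :
    ∃ f s t, s ≤ t ∧ Nonempty (α ≃o Shape.Model (weight f s t)) := by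
  -- Exchanging `x` and `c3` preserves the ends of every vertex, so the result is again a layout and
  -- the smaller of the two fibres may be placed at `x`.
  wlog hxc : Nat.card {y // κ y = .inl x} ≤ Nat.card {y // κ y = .inl c3} generalizing κ
  · have hσ : shape.Layout (swapVertices ∘ κ) :=
      hκ.comp_perm swapVertices (show ∀ v : B8 ⊕ Fin 3, sdn (swapVertices v) = sdn v by decide)
        (show ∀ v : B8 ⊕ Fin 3, sup (swapVertices v) = sup v by decide)
        (show ∀ u : B8, ∃ u' : B8, swapVertices.symm (.inl u) = .inl u' by decide)
    refine this hσ ?_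
    have h1 : ∀ v : B8 ⊕ Fin 3, swapVertices v = .inl x ↔ v = .inl c3 := by decide
    have h2 : ∀ v : B8 ⊕ Fin 3, swapVertices v = .inl c3 ↔ v = .inl x := by decide
    simp only [Function.comp, h1, h2]
    exact le_of_not_ge hxc
  have hpos : ∀ u, 0 < Nat.card {y // κ y = .inl u} := fun u => by
    obtain ⟨y, hy⟩ := hκ.surj u
    have : Nonempty {y // κ y = .inl u} := ⟨⟨y, hy⟩⟩
    exact Nat.card_pos
  let N : B8 ⊕ Fin 3 → ℕ := fun v => Nat.card {y // κ y = v}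
  refine ⟨![N (.inr 0), N (.inr 1), N (.inr 2), N (.inl c1) - 1, N (.inl c2) - 1], N (.inl x) - 1,
    N (.inl c3) - 1, Nat.sub_le_sub_right hxc 1, ?_⟩
  refine hκ.nonempty_orderIso_of_card_fiber (Shape.layout_model _) fun v => ?_
  rw [Shape.card_fiber_model]
  match v with
  | .inl o => exact hκ.card_fiber_rd 0
  | .inl a => exact hκ.card_fiber_rd 1
  | .inl b => exact hκ.card_fiber_rd 2
  | .inl c => exact hκ.card_fiber_rd 3
  | .inl i => exact hκ.card_fiber_rd 4
  | .inl c1 => exact (Nat.sub_add_cancel (hpos c1)).symm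
  | .inl c2 => exact (Nat.sub_add_cancel (hpos c2)).symm
  | .inl x => exact (Nat.sub_add_cancel (hpos x)).symm
  | .inl c3 => exact (Nat.sub_add_cancel (hpos c3)).symm
  | .inr (0 : Fin 3) => rfl
  | .inr (1 : Fin 3) => rfl
  | .inr (2 : Fin 3) => rfl

end B8

/-! ### Counting the parameters. -/

/-- Subtracting one from each part turns the partitions into ordered pairs `s ≤ t` with sum `m`. -/
theorem numPartitionsInto_two (m : ℕ) : numPartitionsInto (m + 2) 2 =
    ((Finset.HasAntidiagonal.antidiagonal m).filter fun q : ℕ × ℕ => q.1 ≤ q.2).card := by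
  symm
  refine Finset.card_bij (fun q hq => ⟨{q.1 + 1, q.2 + 1}, ?_, ?_⟩) ?_ ?_ ?_
  · intro k hk
    simp only [Multiset.insert_eq_cons, Multiset.mem_cons, Multiset.mem_singleton] at hk
    omega
  · simp only [Finset.mem_filter, Finset.HasAntidiagonal.mem_antidiagonal] at hq
    simp only [Multiset.insert_eq_cons, Multiset.sum_cons, Multiset.sum_singleton]
    omega
  · intro q hq
    simp
  · rintro ⟨s, t⟩ hq ⟨s', t'⟩ hq' h
    simp only [Finset.mem_filter, Finset.HasAntidiagonal.mem_antidiagonal] at hq hq'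
    have h1 : ({s + 1, t + 1} : Multiset ℕ) = {s' + 1, t' + 1} := congrArg Nat.Partition.parts h
    have h2 : s + 1 ∈ ({s' + 1, t' + 1} : Multiset ℕ) := h1 ▸ by simp
    simp only [Multiset.insert_eq_cons, Multiset.mem_cons, Multiset.mem_singleton] at h2
    rw [Prod.mk.injEq]
    omega
  · rintro ⟨parts, hpos, hsum⟩ hp
    simp only [Finset.mem_filter, Finset.mem_univ, true_and, Multiset.card_eq_two] at hp
    obtain ⟨s, t, rfl⟩ := hp
    wlog hst : s ≤ t generalizing s t
    · have hc : ({s, t} : Multiset ℕ) = {t, s} := Multiset.cons_swap s t 0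
      obtain ⟨q, hq, h⟩ := this t s (hc ▸ hpos) (hc ▸ hsum) (le_of_not_ge hst)
      refine ⟨q, hq, h.trans ?_⟩
      congr 1
      exact hc.symm
    have hs : 0 < s := hpos (by simp)
    have ht : 0 < t := hpos (by simp)
    simp only [Multiset.insert_eq_cons, Multiset.sum_cons, Multiset.sum_singleton] at hsum
    refine ⟨(s - 1, t - 1), ?_, ?_⟩
    · simp only [Finset.mem_filter, Finset.HasAntidiagonal.mem_antidiagonal]
      omega
    · congr 1
      rw [Nat.sub_add_cancel hs, Nat.sub_add_cancel ht]

namespace B8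

/-- The parameters of the isomorphism classes of blocks on `j` elements with associated basic block
`B₈`: the number `p` of elements below the fourth reducible element, the numbers of elements in
excess at the vertices below it, and the numbers of elements at the two vertices above it. -/
def params (j : ℕ) : Finset (Σ _ : ℕ, (Fin 5 →₀ ℕ) × (ℕ × ℕ)) :=
  (Finset.Icc 6 (j - 3)).sigma fun p => Finset.finsuppAntidiag Finset.univ (p - 6) ×ˢ
    (Finset.HasAntidiagonal.antidiagonal (j - p - 3)).filter fun q : ℕ × ℕ => q.1 ≤ q.2

theorem mem_params {j : ℕ} (a : Σ _ : ℕ, (Fin 5 →₀ ℕ) × (ℕ × ℕ)) :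
    a ∈ params j ↔ ∑ k, a.2.1 k + a.2.2.1 + a.2.2.2 + 9 = j ∧ a.1 = ∑ k, a.2.1 k + 6 ∧
      a.2.2.1 ≤ a.2.2.2 := by
  simp only [params, Finset.mem_sigma, Finset.mem_Icc, Finset.mem_product,
    Finset.mem_finsuppAntidiag, Finset.mem_filter, Finset.HasAntidiagonal.mem_antidiagonal, Finset.subset_univ,
    and_true]
  rw [show Finset.univ.sum a.2.1 = ∑ k, a.2.1 k from rfl]
  omega

/-- Stars and bars: five summands with total `p - 6` can be chosen in `(p - 2).choose (p - 6)` ways,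
which is `(p - 2).choose 4` by symmetry. -/
theorem card_params (j : ℕ) : (params j).card =
    ∑ p ∈ Finset.Icc 6 (j - 3), (p - 2).choose 4 * numPartitionsInto (j - p - 1) 2 := by
  rw [params, Finset.card_sigma]
  refine Finset.sum_congr rfl fun p hp => ?_
  rw [Finset.mem_Icc] at hp
  rw [Finset.card_product, Finset.card_finsuppAntidiag_nat_eq_choose, Finset.card_univ,
    Fintype.card_fin, show j - p - 1 = j - p - 3 + 2 by omega, numPartitionsInto_two,
    show 5 + (p - 6) - 1 = p - 2 by omega, ← Nat.choose_symm (by omega : p - 6 ≤ p - 2),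
    show p - 2 - (p - 6) = 4 by omega]

theorem inClass_iff {j : ℕ} (L : LatticeOn j) :
    InClassWithBasicBlock B8 L ↔ ∃ κ : L.Carrier → shape.V, shape.Layout κ := class_iff

theorem exists_latticeOn_model {j : ℕ} {f : Fin 5 → ℕ} {s t : ℕ} (h : ∑ k, f k + s + t + 9 = j) :
    ∃ L : LatticeOn j, Nonempty (L.Carrier ≃o Shape.Model (weight f s t)) := by
  obtain ⟨L, ⟨e⟩⟩ := @LatticeOn.exists_orderIso _ (Shape.layout_model (weight f s t)).lattice
    inferInstance j ((card_model f s t).trans h)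
  exact ⟨L, ⟨e⟩⟩

/-- Each parameter is sent to the class of its model lattice. Injectivity is `eq_of_orderIso_model`,
where `s ≤ t` removes the ambiguity of the exchange, and surjectivity is `exists_orderIso_model`. -/
theorem numIsoClasses_eq (j : ℕ) : numIsoClasses j (fun L => InClassWithBasicBlock B8 L) =
    ∑ p ∈ Finset.Icc 6 (j - 3), (p - 2).choose 4 * numPartitionsInto (j - p - 1) 2 := by
  rw [← card_params, ← Set.ncard_coe_finset, numIsoClasses]
  symm
  have hex : ∀ a : (Σ _ : ℕ, (Fin 5 →₀ ℕ) × (ℕ × ℕ)), a ∈ (params j : Set _) → ∃ L : LatticeOn j,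
      Nonempty (L.Carrier ≃o Shape.Model (weight a.2.1 a.2.2.1 a.2.2.2)) := fun a ha =>
    exists_latticeOn_model ((mem_params a).1 ha).1
  refine Set.ncard_congr (fun a ha => Quotient.mk _ (hex a ha).choose) ?_ ?_ ?_
  · intro a ha
    obtain ⟨e⟩ := (hex a ha).choose_spec
    exact ⟨_, (inClass_iff _).2 ⟨_, (Shape.layout_model _).comp e⟩, rfl⟩
  · rintro ⟨p, f, s, t⟩ ⟨p', f', s', t'⟩ ha hb h
    obtain ⟨e⟩ := (hex _ ha).choose_spec
    obtain ⟨e'⟩ := (hex _ hb).choose_spec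
    obtain ⟨i⟩ := Quotient.exact h
    obtain ⟨-, h1, h2⟩ := (mem_params _).1 ha
    obtain ⟨-, h1', h2'⟩ := (mem_params _).1 hb
    obtain ⟨hf, rfl, rfl⟩ := eq_of_orderIso_model h2 h2' e (i.trans e')
    obtain rfl := DFunLike.coe_injective hf
    obtain rfl : p = p' := h1.trans h1'.symm
    rfl
  · rintro _ ⟨L, hL, rfl⟩
    obtain ⟨κ, hκ⟩ := (inClass_iff L).1 hL
    obtain ⟨f, s, t, hst, ⟨e⟩⟩ := exists_orderIso_model hκ
    have hj : ∑ k, f k + s + t + 9 = j := by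
      rw [← card_model, ← Nat.card_congr e.toEquiv, L.card_carrier]
    have ha : (⟨∑ k, f k + 6, Finsupp.equivFunOnFinite.symm f, s, t⟩ :
        Σ _ : ℕ, (Fin 5 →₀ ℕ) × (ℕ × ℕ)) ∈ params j := (mem_params _).2 ⟨hj, rfl, hst⟩
    refine ⟨_, ha, Quotient.sound ?_⟩
    obtain ⟨e'⟩ := (hex _ ha).choose_spec
    exact ⟨e'.trans e.symm⟩

end B8

theorem mainTheorem11 (j : ℕ) (hj : 9 ≤ j) :
    numIsoClasses j (fun L => InClassWithBasicBlock B8 L) =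
        ∑ p ∈ Finset.Icc 6 (j - 3), (p - 2).choose 4 * numPartitionsInto (j - p - 1) 2 ∧
    numIsoClasses j (fun L => InClassWithBasicBlock B9 L) =
        ∑ p ∈ Finset.Icc 6 (j - 3), (p - 2).choose 4 * numPartitionsInto (j - p - 1) 2 ∧
    (∀ L : LatticeOn j, InClassWithBasicBlock B9 L ↔ InClassWithBasicBlock B8 L.dual) ∧
    (∀ L : LatticeOn j, InClassWithBasicBlock B8 L ↔
      ∃ p q : ℕ, 6 ≤ p ∧ 4 ≤ q ∧ p + q = j + 1 ∧
        ∃ (L' : LatticeOn p) (L'' : LatticeOn q),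
          InClassWithHeight 4 2 3 L' ∧ InClassWithHeight 2 1 2 L'' ∧
            Nonempty (L.Carrier ≃o VerticalSum L'.Carrier L''.Carrier)) :=
  ⟨B8.numIsoClasses_eq j, (numIsoClasses_B9_eq j).trans (B8.numIsoClasses_eq j), inClass_B9_iff,
    B8.class_iff_exists_verticalSum⟩
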